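/- Let $\gamma,\lambda,\mu>0$ and let $Q=H^1(\mathbb R^+)\oplus H^1(\mathbb R^-)$ be the space of complex-valued functions on $\mathbb R$ whose restrictions to the two open half-lines are in $H^1$, with norm $\|\psi\|_Q^2=\|\psi\|_2^2+\|\psi'\|_2^2$, where $\psi'$ is the derivative away from the origin. For $\omega\in\mathbb R$ and $\psi\in Q$, with boundary values $\psi(0\pm)$, put $$S_\omega(\psi)=\tfrac12\|\psi'\|_2^2-\tfrac1{2\gamma}|\psi(0+)-\psi(0-)|^2+\tfrac\omega2\|\psi\|_2^2-\tfrac{\lambda}{2\mu+2}\|\psi\|_{2\mu+2}^{2\mu+2},$$ $$I_\omega(\psi)=\|\psi'\|_2^2-\tfrac1\gamma|\psi(0+)-\psi(0-)|^2+\omega\|\psi\|_2^2-\lambda\|\psi\|_{2\mu+2}^{2\mu+2},\qquad \widetilde S(\psi)=\tfrac{\lambda\mu}{2(\mu+1)}\|\psi\|_{2\mu+2}^{2\mu+2},$$ $$d(\omega)=\inf\{S_\omega(\psi):\psi\in Q\setminus\{0\},\ I_\omega(\psi)=0\}.$$ **Theorem.** Let $\omega>4/\gamma^2$. 1. There is $\psi\in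 Q\setminus\{0\}$ with $I_\omega(\psi)=0$ and $S_\omega(\psi)=d(\omega)$; thus $\psi$ minimizes $S_\omega$ on the Nehari manifold $\{\varphi\in Q\setminus\{0\}: I_\omega(\varphi)=0\}$. Moreover $\psi$ minimizes $\widetilde S$ on $\{\varphi\in Q\setminus\{0\}: I_\omega(\varphi)\le 0\}$. 2. If $(\psi_n)$ is a minimizing sequence for $S_\omega$ on $\{\varphi\in Q\setminus\{0\}: I_\omega(\varphi)=0\}$, or a minimizing sequence for $\widetilde S$ on $\{\varphi\in Q\setminus\{0\}: I_\omega(\varphi)\le0\}$, and $(\psi_n)$ converges weakly in $Q$ to some $\psi_\infty\in Q$, then $\psi_n\to\psi_\infty$ strongly in $Q$. Here a minimizing sequence for a functional on a set is a sequence of elements of the set along which the functional converges to its infimum over the set. -/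

import Mathlib

open MeasureTheory Filter Topology Set

noncomputable section

namespace DeltaPrime

/-- The complex Hilbert space `L²(ℝ)`, identified with `L²(ℝ⁺) ⊕ L²(ℝ⁻)`. -/
abbrev L2 : Type := Lp ℂ 2 (volume : Measure ℝ)

/-- `v` is the distributional derivative of `u` on the open set `Ω ⊆ ℝ`. -/
def HasWeakDerivOn (Ω : Set ℝ) (u v : L2) : Prop :=
  ∀ φ : ℝ → ℝ, ContDiff ℝ (⊤ : ℕ∞) φ → HasCompactSupport φ → tsupport φ ⊆ Ω →
    ∫ x, deriv φ x • u x = - ∫ x, φ x • v x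

lemma integrable_test_smul {φ : ℝ → ℝ} (hφ : Continuous φ) (hc : HasCompactSupport φ) (u : L2) :
    Integrable (fun x => φ x • u x) :=
  ((Lp.memLp u).locallyIntegrable (by norm_num)).integrable_smul_left_of_hasCompactSupport hφ hc

lemma hasWeakDerivOn_zero (Ω : Set ℝ) : HasWeakDerivOn Ω 0 0 := by
  intro φ _ _ _
  have h0 : ∀ g : ℝ → ℝ, ∫ x, g x • (0 : L2) x = 0 := by
    intro g
    refine integral_eq_zero_of_ae ?_
    filter_upwards [Lp.coeFn_zero ℂ 2 (volume : Measure ℝ)] with x hx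
    rw [hx]
    simp
  rw [h0, h0, neg_zero]

lemma HasWeakDerivOn.add {Ω : Set ℝ} {u v u' v' : L2} (h : HasWeakDerivOn Ω u v)
    (h' : HasWeakDerivOn Ω u' v') : HasWeakDerivOn Ω (u + u') (v + v') := by
  intro φ hφ hc hs
  have key : ∀ (g : ℝ → ℝ), Continuous g → HasCompactSupport g → ∀ a b : L2,
      ∫ x, g x • (a + b : L2) x = (∫ x, g x • a x) + ∫ x, g x • b x := by
    intro g hg hgc a b
    rw [← integral_add (integrable_test_smul hg hgc a) (integrable_test_smul hg hgc b)]
    refine integral_congr_ae ?_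
    filter_upwards [Lp.coeFn_add a b] with x hx
    rw [hx, Pi.add_apply, smul_add]
  rw [key _ (hφ.continuous_deriv (by simp)) hc.deriv, key _ hφ.continuous hc,
    h φ hφ hc hs, h' φ hφ hc hs]
  ring

lemma HasWeakDerivOn.smul {Ω : Set ℝ} {u v : L2} (c : ℂ) (h : HasWeakDerivOn Ω u v) :
    HasWeakDerivOn Ω (c • u) (c • v) := by
  intro φ hφ hc hs
  have key : ∀ (g : ℝ → ℝ) (a : L2), ∫ x, g x • (c • a : L2) x = c • ∫ x, g x • a x := by
    intro g a
    rw [← integral_smul]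
    refine integral_congr_ae ?_
    filter_upwards [Lp.coeFn_smul c a] with x hx
    rw [hx, Pi.smul_apply, smul_comm]
  rw [key, key, h φ hφ hc hs, smul_neg]

/-- The energy space `H¹(ℝ⁺) ⊕ H¹(ℝ⁻)`. An element is stored as the pair `(ψ, ψ')` of a function
`ψ ∈ L²(ℝ)` and its piecewise derivative `ψ' ∈ L²(ℝ)` (the weak derivative on each open half-line,
which `ψ` determines; a jump at the origin is allowed). The Hilbert structure inherited from
`L² × L²` is `(φ, ψ)_Q = (φ, ψ) + (φ', ψ')`, so that `‖ψ‖_Q² = ‖ψ‖² + ‖ψ'‖²`. -/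
def energySpace : Submodule ℂ (WithLp 2 (L2 × L2)) where
  carrier := {p | HasWeakDerivOn (Ioi 0) p.fst p.snd ∧ HasWeakDerivOn (Iio 0) p.fst p.snd}
  zero_mem' := ⟨hasWeakDerivOn_zero _, hasWeakDerivOn_zero _⟩
  add_mem' h h' := ⟨h.1.add h'.1, h.2.add h'.2⟩
  smul_mem' c _ h := ⟨h.1.smul c, h.2.smul c⟩

/-- The energy space as a type, with its inner product. -/
abbrev Q : Type := ↥energySpace

/-- The function `ψ`. -/
def Q.fn (ψ : Q) : L2 := (ψ : WithLp 2 (L2 × L2)).fst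

/-- The piecewise derivative `ψ'`. -/
def Q.dfn (ψ : Q) : L2 := (ψ : WithLp 2 (L2 × L2)).snd

/-- The boundary value `ψ(0+)`: the essential limit of `ψ(x)` as `x → 0`, `x > 0`
(that is, the limit at `0` of the continuous representative of `ψ` on `(0, ∞)`). -/
def Q.rightValue (ψ : Q) : ℂ := limUnder (𝓝[>] (0 : ℝ) ⊓ ae volume) ψ.fn

/-- The boundary value `ψ(0-)`. -/
def Q.leftValue (ψ : Q) : ℂ := limUnder (𝓝[<] (0 : ℝ) ⊓ ae volume) ψ.fn

/-- The quadratic form `F_γ(ψ) = ‖ψ'‖² - γ⁻¹ |ψ(0+) - ψ(0-)|²` of the `δ'` interaction. -/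
def quadForm (γ : ℝ) (ψ : Q) : ℝ :=
  ‖ψ.dfn‖ ^ 2 - γ⁻¹ * ‖ψ.rightValue - ψ.leftValue‖ ^ 2

/-- The mass `M(ψ) = ‖ψ‖²`. -/
def mass (ψ : Q) : ℝ := ‖ψ.fn‖ ^ 2

/-- `‖ψ‖_p^p` with `p = 2μ + 2`. -/
def powerNorm (μ : ℝ) (ψ : Q) : ℝ := ∫ x, ‖ψ.fn x‖ ^ (2 * μ + 2)

/-- The energy `E`. -/
def energy (γ lam μ : ℝ) (ψ : Q) : ℝ :=
  1 / 2 * quadForm γ ψ - lam / (2 * μ + 2) * powerNorm μ ψ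

/-- The action `S_ω = E + (ω / 2) M`. -/
def action (γ lam μ ω : ℝ) (ψ : Q) : ℝ := energy γ lam μ ψ + ω / 2 * mass ψ

/-- The Nehari functional `I_ω`. -/
def nehari (γ lam μ ω : ℝ) (ψ : Q) : ℝ :=
  quadForm γ ψ + ω * mass ψ - lam * powerNorm μ ψ

/-- The reduced action `S̃`. -/
def reducedAction (lam μ : ℝ) (ψ : Q) : ℝ := lam * μ / (2 * (μ + 1)) * powerNorm μ ψ

/-- The Nehari manifold: nonzero `ψ ∈ Q` with `I_ω(ψ) = 0`. -/
def nehariManifold (γ lam μ ω : ℝ) : Set Q := {ψ | ψ ≠ 0 ∧ nehari γ lam μ ω ψ = 0}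

/-- The nonzero `ψ ∈ Q` with `I_ω(ψ) ≤ 0`. -/
def nehariRegion (γ lam μ ω : ℝ) : Set Q := {ψ | ψ ≠ 0 ∧ nehari γ lam μ ω ψ ≤ 0}

/-- `d(ω)`, the infimum of the action on the Nehari manifold. -/
def d (γ lam μ ω : ℝ) : ℝ := sInf (action γ lam μ ω '' nehariManifold γ lam μ ω)

/-- `u` is a minimizing sequence for the functional `J` on the set `A`: its members lie in `A`
and `J (u n)` converges to the (finite) infimum of `J` on `A`. -/
def IsMinimizingSeq (J : Q → ℝ) (A : Set Q) (u : ℕ → Q) : Prop :=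
  (∀ n, u n ∈ A) ∧ ∃ m, IsGLB (J '' A) m ∧ Tendsto (fun n => J (u n)) atTop (𝓝 m)

/-- Weak convergence in `Q`, tested against all bounded linear functionals. -/
def WeaklyTendsto (u : ℕ → Q) (ψ : Q) : Prop :=
  ∀ ℓ : Q →L[ℂ] ℂ, Tendsto (fun n => ℓ (u n)) atTop (𝓝 (ℓ ψ))

end DeltaPrime

end

noncomputable section

namespace DeltaPrime

/-! Write P for `powerNorm`, N for `nehariQuad` and I = N - λP for `nehari`. On the Nehari manifold
the action equals `reducedAction`, a positive multiple of P (`action_eq`). A nonzero function with I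
< 0 can be scaled down to the manifold, strictly lowering P (`exists_smul_mem_nehariManifold`,
`powerNorm_smul_lt`). Both variational problems therefore amount to minimizing P over I ≤ 0, with
infimum `level`.

The condition ω > 4/γ² is what makes N coercive (`exists_coercive`). It enters through a trace
inequality with a free parameter a, derived from u(x) = ∫_{s>x} e^{a(x-s)} (a u - u')(s) ds
(`HasWeakDerivOn.ae_eq_expTail`). The same formula makes point values bounded functionals, so weak
convergence in Q gives pointwise convergence almost everywhere. Coercivity bounds minimizing
sequences and makes `level` positive.

The weak limit of a minimizing sequence cannot be zero (`not_weaklyTendsto_zero`). Otherwise the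
boundary values tend to zero and can be removed at negligible cost, so the point interaction is not
felt. Cutting such a function where it is large and moving the cut to the origin creates a jump,
which the attractive interaction rewards by a fixed amount (`exists_competitor`). One of the two
halves then has I bounded away from zero below, and scaling it down brings P under `level`
(`exists_level_le_mul`).

For a nonzero weak limit ψ, the Brezis–Lieb splitting (`tendsto_powerNorm_split`) and its Hilbert
space analogue (`tendsto_norm_sq_split`) distribute P and I between ψ and the remainder u_n - ψ. If
I(ψ) > 0, the remainder would satisfy I < 0 while P tends to `level` - P(ψ), which is too small. So
ψ is a minimizer with I(ψ) = 0, and coercivity of N on the remainder gives strong convergence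
(`tendsto_of_minimizing`). Existence follows by weak compactness of bounded sequences. -/

/-! ### Exponential averages and the representation formula on a half-line -/

lemma exp_tail_sq_integral {a : ℝ} (ha : 0 < a) (x : ℝ) :
    IntegrableOn (fun s => Real.exp (a * (x - s)) ^ 2) (Ioi x) ∧
      ∫ s in Ioi x, Real.exp (a * (x - s)) ^ 2 = 1 / (2 * a) := by
  have e : (fun s => Real.exp (a * (x - s)) ^ 2)
      = fun s => Real.exp (2 * a * x) * Real.exp ((-(2 * a)) * s) := by
    funext s
    rw [← Real.exp_nat_mul, ← Real.exp_add]
    congr 1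
    push_cast
    ring
  have hneg : -(2 * a) < 0 := by linarith
  rw [e]
  refine ⟨(integrableOn_exp_mul_Ioi hneg x).const_mul _, ?_⟩
  rw [integral_const_mul, integral_exp_mul_Ioi hneg]
  have : Real.exp (2 * a * x) * Real.exp (-(2 * a) * x) = 1 := by
    rw [← Real.exp_add]; simp
  rw [mul_div_assoc', mul_neg, this, neg_div_neg_eq]

/-- The function `s ↦ e^{a (x - s)}` on `(x, ∞)`, extended by zero. -/
def expKernelFun (a x : ℝ) : ℝ → ℂ :=
  (Ioi x).indicator (fun s => (Real.exp (a * (x - s)) : ℂ))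

lemma memLp_expKernelFun {a : ℝ} (ha : 0 < a) (x : ℝ) :
    MemLp (expKernelFun a x) 2 volume := by
  unfold expKernelFun
  rw [memLp_indicator_iff_restrict measurableSet_Ioi]
  have hc : Continuous (fun s => (Real.exp (a * (x - s)) : ℂ)) := by fun_prop
  rw [memLp_two_iff_integrable_sq_norm hc.aestronglyMeasurable]
  have := (exp_tail_sq_integral ha x).1
  refine this.congr ?_
  filter_upwards with s
  rw [Complex.norm_real, Real.norm_eq_abs, sq_abs]

/-- `expKernelFun a x` as an element of `L²`. -/
def expKernel {a : ℝ} (ha : 0 < a) (x : ℝ) : L2 := (memLp_expKernelFun ha x).toLp _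

/-- `∫_{s > x} e^{a (x - s)} g(s) ds`. -/
def expTail (a x : ℝ) (g : ℝ → ℂ) : ℂ := ∫ s in Ioi x, Real.exp (a * (x - s)) • g s

lemma L2_norm_sq (u : L2) : ‖u‖ ^ 2 = ∫ x, ‖u x‖ ^ 2 := by
  have h := inner_self_eq_norm_sq_to_K (𝕜 := ℂ) u
  rw [L2.inner_def] at h
  have h2 : ∀ x, inner ℂ (u x) (u x) = ((‖u x‖ ^ 2 : ℝ) : ℂ) := by
    intro x
    rw [inner_self_eq_norm_sq_to_K]
    norm_cast
  simp_rw [h2] at h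
  rw [integral_complex_ofReal] at h
  exact Complex.ofReal_injective (by rw [Complex.ofReal_pow]; exact h.symm)

lemma L2_integrable_sq (u : L2) : Integrable (fun x => ‖u x‖ ^ 2) :=
  (memLp_two_iff_integrable_sq_norm (Lp.aestronglyMeasurable u)).1 (Lp.memLp u)

lemma norm_expKernel_sq {a : ℝ} (ha : 0 < a) (x : ℝ) : ‖expKernel ha x‖ ^ 2 = 1 / (2 * a) := by
  rw [L2_norm_sq, ← (exp_tail_sq_integral ha x).2, ← integral_indicator measurableSet_Ioi]
  refine integral_congr_ae ?_
  filter_upwards [(memLp_expKernelFun ha x).coeFn_toLp] with s hs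
  rw [expKernel, hs, expKernelFun]
  by_cases h : s ∈ Ioi x
  · rw [indicator_of_mem h, indicator_of_mem h, Complex.norm_real, Real.norm_eq_abs, sq_abs]
  · rw [indicator_of_notMem h, indicator_of_notMem h]; simp

/-- Exhibits the average as a bounded functional of `g`, of norm (2a)^{-1/2}; the continuity of
point evaluation on Q rests on this. -/
lemma inner_expKernel {a : ℝ} (ha : 0 < a) (x : ℝ) (g : L2) :
    inner ℂ (expKernel ha x) g = expTail a x g := by
  rw [L2.inner_def, expTail, ← integral_indicator measurableSet_Ioi]
  refine integral_congr_ae ?_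
  filter_upwards [(memLp_expKernelFun ha x).coeFn_toLp] with s hs
  rw [expKernel, hs, expKernelFun]
  by_cases h : s ∈ Ioi x
  · rw [indicator_of_mem h, indicator_of_mem h]
    simp [RCLike.inner_apply, mul_comm, -Complex.ofReal_exp, Complex.conj_ofReal]
  · rw [indicator_of_notMem h, indicator_of_notMem h]; simp

lemma integrableOn_exp_smul {a : ℝ} (ha : 0 < a) (x y : ℝ) (g : L2) :
    IntegrableOn (fun s => Real.exp (a * (y - s)) • g s) (Ioi x) := by
  have h1 : IntegrableOn (fun s => Real.exp (a * (x - s)) • g s) (Ioi x) := by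
    have := L2.integrable_inner (𝕜 := ℂ) (expKernel ha x) g
    rw [← integrable_indicator_iff measurableSet_Ioi]
    refine this.congr ?_
    filter_upwards [(memLp_expKernelFun ha x).coeFn_toLp] with s hs
    rw [expKernel, hs, expKernelFun]
    by_cases h : s ∈ Ioi x
    · rw [indicator_of_mem h, indicator_of_mem h]
      simp [RCLike.inner_apply, mul_comm, -Complex.ofReal_exp, Complex.conj_ofReal]
    · rw [indicator_of_notMem h, indicator_of_notMem h]; simp
  have h2 : (fun s => Real.exp (a * (y - s)) • g s) =
      fun s => Real.exp (a * (y - x)) • (Real.exp (a * (x - s)) • g s) := by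
    funext s
    rw [smul_smul, ← Real.exp_add]
    congr 2
    ring
  rw [h2]
  exact Integrable.smul (Real.exp (a * (y - x))) h1

lemma continuous_expTail {a : ℝ} (ha : 0 < a) (g : L2) : Continuous (fun x => expTail a x g) := by
  have h0 : ∀ x, IntegrableOn (fun s => Real.exp (a * (0 - s)) • g s) (Ioi x) :=
    fun x => integrableOn_exp_smul ha x 0 g
  -- Factoring out e^{ax} leaves an integrand independent of x, so only a primitive depends on x.
  have e : (fun x => expTail a x g) = fun x => Real.exp (a * x) •
      ((∫ s in Ioi 0, Real.exp (a * (0 - s)) • g s)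
        - ∫ s in (0 : ℝ)..x, Real.exp (a * (0 - s)) • g s) := by
    funext x
    rw [← intervalIntegral.integral_Ioi_sub_Ioi' (h0 0) (h0 x), sub_sub_cancel, expTail,
      ← integral_smul]
    refine integral_congr_ae ?_
    filter_upwards with s
    rw [smul_smul, ← Real.exp_add]
    congr 2
    ring
  rw [e]
  have hc : Continuous fun x => ∫ s in (0 : ℝ)..x, Real.exp (a * (0 - s)) • g s := by
    refine intervalIntegral.continuous_primitive (fun b c => ?_) 0
    rw [intervalIntegrable_iff]
    exact (h0 (min b c)).mono_set (fun z hz => hz.1)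
  fun_prop

lemma integral_smul_expTail {a : ℝ} (ha : 0 < a) {Ψ : ℝ → ℝ} (hΨ : Continuous Ψ)
    (hc : HasCompactSupport Ψ) (g : L2) :
    ∫ x in Ioi 0, Ψ x • expTail a x g =
      ∫ s in Ioi 0, (∫ x in (0 : ℝ)..s, Ψ x * Real.exp (a * (x - s))) • g s := by
  set K : ℝ → ℝ → ℂ := fun x s => (Ioi x).indicator
    (fun s => (Ψ x * Real.exp (a * (x - s))) • g s) s with hK
  have hL : ∀ x ∈ Ioi (0 : ℝ), Ψ x • expTail a x g = ∫ s in Ioi 0, K x s := by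
    intro x hx
    rw [hK, integral_indicator measurableSet_Ioi, Measure.restrict_restrict measurableSet_Ioi,
      inter_eq_left.2 (Ioi_subset_Ioi (le_of_lt hx)), expTail, ← integral_smul]
    simp_rw [smul_smul]
  have hR : ∀ s ∈ Ioi (0 : ℝ), (∫ x in (0 : ℝ)..s, Ψ x * Real.exp (a * (x - s))) • g s
      = ∫ x in Ioi 0, K x s := by
    intro s hs
    have e : (fun x => K x s) = (Iio s).indicator
        (fun x => (Ψ x * Real.exp (a * (x - s))) • g s) := by
      funext x
      simp only [hK, indicator, mem_Ioi, mem_Iio]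
    rw [e, integral_indicator measurableSet_Iio, Measure.restrict_restrict measurableSet_Iio,
      inter_comm, Ioi_inter_Iio, integral_smul_const,
      intervalIntegral.integral_of_le (le_of_lt hs), integral_Ioc_eq_integral_Ioo]
  rw [setIntegral_congr_fun measurableSet_Ioi hL, setIntegral_congr_fun measurableSet_Ioi hR]
  apply integral_integral_swap
  -- Since e^{a(x-s)} = e^{ax} e^{-as}, the double integrand is a product of integrable functions of
  -- one variable, cut off to x < s. This justifies Fubini.
  have hbound : Integrable (fun z : ℝ × ℝ => (Ψ z.1 * Real.exp (a * z.1)) •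
      (Real.exp (a * (0 - z.2)) • g z.2))
      ((volume.restrict (Ioi 0)).prod (volume.restrict (Ioi 0))) := by
    refine Integrable.smul_prod (f := fun x => Ψ x * Real.exp (a * x))
      (g := fun s => Real.exp (a * (0 - s)) • g s) ?_ ?_
    · have : Continuous fun x => Ψ x * Real.exp (a * x) := by fun_prop
      exact (this.integrable_of_hasCompactSupport hc.mul_right).integrableOn
    · exact integrableOn_exp_smul ha 0 0 g
  have hset : MeasurableSet {z : ℝ × ℝ | z.1 < z.2} := measurableSet_lt measurable_fst measurable_snd
  refine (hbound.indicator hset).congr ?_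
  filter_upwards with z
  simp only [Function.uncurry, hK, indicator, mem_Ioi, mem_ofPred_eq]
  split_ifs
  · rw [smul_smul, mul_assoc, ← Real.exp_add]
    congr 3
    ring
  · rfl

lemma integrable_smul_L2 {Φ : ℝ → ℝ} (hΦ : MemLp Φ 2 volume) (u : L2) :
    Integrable (fun x => Φ x • u x) :=
  memLp_one_iff_integrable.1 ((Lp.memLp u).smul (r := 1) hΦ)

/-- The weak derivative may be tested against smooth functions in `H¹` that are not compactly
supported. -/
lemma HasWeakDerivOn.integral_of_memLp {Ω : Set ℝ} {u v : L2} (h : HasWeakDerivOn Ω u v)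
    {Φ : ℝ → ℝ} (hΦ : ContDiff ℝ (⊤ : ℕ∞) Φ) (hs : tsupport Φ ⊆ Ω) (h2 : MemLp Φ 2 volume)
    (h2' : MemLp (deriv Φ) 2 volume) :
    ∫ x, deriv Φ x • u x = - ∫ x, Φ x • v x := by
  -- Test with Φ(x) χ(x/(n+1)): the cutoff tends to 1, its derivative is O(1/(n+1)), and dominated
  -- convergence gives the limit.
  let χ : ContDiffBump (0 : ℝ) := ⟨1, 2, one_pos, one_lt_two⟩
  have hχs : ContDiff ℝ (⊤ : ℕ∞) χ := χ.contDiff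
  have hχd : Continuous (deriv χ) := hχs.continuous_deriv (by simp)
  obtain ⟨C, hC⟩ := χ.hasCompactSupport.deriv.exists_bound_of_continuous hχd
  have hC0 : 0 ≤ C := (norm_nonneg _).trans (hC 0)
  let c : ℕ → ℝ := fun n => 1 / ((n : ℝ) + 1)
  have hcpos : ∀ n, 0 < c n := fun n => by positivity
  have hcle : ∀ n, c n ≤ 1 := fun n => by
    have : (0 : ℝ) ≤ n := n.cast_nonneg
    exact (div_le_one (by positivity)).2 (by linarith)
  have hclim : Tendsto c atTop (𝓝 0) := tendsto_one_div_add_atTop_nhds_zero_nat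
  let ξ : ℕ → ℝ → ℝ := fun n x => χ (c n * x)
  have hξs : ∀ n, ContDiff ℝ (⊤ : ℕ∞) (ξ n) := fun n =>
    hχs.comp (contDiff_const.mul contDiff_id)
  have hξd : ∀ n x, HasDerivAt (ξ n) (deriv χ (c n * x) * c n) x := by
    intro n x
    have h1 : HasDerivAt χ (deriv χ (c n * x)) (c n * x) :=
      (hχs.differentiable (by simp) _).hasDerivAt
    have h2 : HasDerivAt (fun y => c n * y) (c n) x := by
      simpa using (hasDerivAt_id x).const_mul (c n)
    exact h1.comp x h2
  have hξc : ∀ n, HasCompactSupport (ξ n) := fun n =>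
    χ.hasCompactSupport.comp_homeomorph (Homeomorph.mulLeft₀ (c n) (hcpos n).ne')
  have hΦd : ∀ x, HasDerivAt Φ (deriv Φ x) x := fun x =>
    (hΦ.differentiable (by simp) x).hasDerivAt
  have hd : ∀ n x, deriv (fun y => Φ y * ξ n y) x
      = deriv Φ x * ξ n x + Φ x * (deriv χ (c n * x) * c n) := fun n x =>
    ((hΦd x).mul (hξd n x)).deriv
  have key : ∀ n, ∫ x, (deriv Φ x * ξ n x + Φ x * (deriv χ (c n * x) * c n)) • u x
      = - ∫ x, (Φ x * ξ n x) • v x := by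
    intro n
    have := h (fun y => Φ y * ξ n y) (hΦ.mul (hξs n)) (hξc n).mul_left
      ((tsupport_mul_subset_left).trans hs)
    simpa only [hd] using this
  have hξlim : ∀ x, Tendsto (fun n => ξ n x) atTop (𝓝 1) := by
    intro x
    have h1 : Tendsto (fun n => c n * x) atTop (𝓝 0) := by simpa using hclim.mul_const x
    have h2 : χ 0 = 1 := χ.one_of_mem_closedBall (Metric.mem_closedBall_self χ.rIn_pos.le)
    rw [← h2]
    exact (hχs.continuous.tendsto 0).comp h1
  have hξb : ∀ n x, |ξ n x| ≤ 1 := fun n x => by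
    rw [abs_of_nonneg χ.nonneg]; exact χ.le_one
  have hi1 : Integrable (fun x => ‖deriv Φ x • u x‖ + C * ‖Φ x • u x‖) :=
    (integrable_smul_L2 h2' u).norm.add ((integrable_smul_L2 h2 u).norm.const_mul C)
  have hi2 : Integrable (fun x => ‖Φ x • v x‖) := (integrable_smul_L2 h2 v).norm
  have hum := Lp.aestronglyMeasurable u
  have hvm := Lp.aestronglyMeasurable v
  have hΦ'c : Continuous (deriv Φ) := hΦ.continuous_deriv (by simp)
  have hΦc : Continuous Φ := hΦ.continuous
  have L1 : Tendsto (fun n => ∫ x, (deriv Φ x * ξ n x + Φ x * (deriv χ (c n * x) * c n)) • u x)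
      atTop (𝓝 (∫ x, deriv Φ x • u x)) := by
    refine tendsto_integral_of_dominated_convergence _ (fun n => ?_) hi1 (fun n => ?_) ?_
    · have hcont : Continuous fun x =>
          deriv Φ x * ξ n x + Φ x * (deriv χ (c n * x) * c n) := by
        have := (hξs n).continuous
        fun_prop
      exact hcont.aestronglyMeasurable.smul hum
    · filter_upwards with x
      rw [norm_smul, norm_smul, norm_smul, ← mul_assoc C, ← add_mul]
      refine mul_le_mul_of_nonneg_right ?_ (norm_nonneg _)
      refine (norm_add_le _ _).trans ?_
      simp only [norm_mul, Real.norm_eq_abs]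
      have e1 : |deriv Φ x| * |ξ n x| ≤ |deriv Φ x| * 1 :=
        mul_le_mul_of_nonneg_left (hξb n x) (abs_nonneg _)
      have e2 : |deriv χ (c n * x)| * |c n| ≤ C * 1 := by
        refine mul_le_mul (hC _) ?_ (abs_nonneg _) hC0
        rw [abs_of_pos (hcpos n)]; exact hcle n
      have e3 : |Φ x| * (|deriv χ (c n * x)| * |c n|) ≤ |Φ x| * (C * 1) :=
        mul_le_mul_of_nonneg_left e2 (abs_nonneg _)
      linarith
    · filter_upwards with x
      have t2 : Tendsto (fun n => deriv χ (c n * x) * c n) atTop (𝓝 0) := by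
        refine squeeze_zero_norm (fun n => ?_) (by simpa using hclim.const_mul C)
        rw [norm_mul, Real.norm_of_nonneg (hcpos n).le]
        exact mul_le_mul_of_nonneg_right (hC _) (hcpos n).le
      have t3 : Tendsto (fun n => deriv Φ x * ξ n x + Φ x * (deriv χ (c n * x) * c n)) atTop
          (𝓝 (deriv Φ x)) := by
        simpa using ((hξlim x).const_mul (deriv Φ x)).add (t2.const_mul (Φ x))
      exact t3.smul_const _
  have L2 : Tendsto (fun n => ∫ x, (Φ x * ξ n x) • v x) atTop (𝓝 (∫ x, Φ x • v x)) := by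
    refine tendsto_integral_of_dominated_convergence _ (fun n => ?_) hi2 (fun n => ?_) ?_
    · exact (hΦc.mul (hξs n).continuous).aestronglyMeasurable.smul hvm
    · filter_upwards with x
      rw [norm_smul, norm_smul, norm_mul]
      refine mul_le_mul_of_nonneg_right ?_ (norm_nonneg _)
      exact mul_le_of_le_one_right (norm_nonneg _) (hξb n x)
    · filter_upwards with x
      have t3 : Tendsto (fun n => Φ x * ξ n x) atTop (𝓝 (Φ x)) := by
        simpa using (hξlim x).const_mul (Φ x)
      exact t3.smul_const _
  simp_rw [key] at L1
  exact tendsto_nhds_unique L1 L2.neg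

/-- The bounded solution of `Φ' = φ - a Φ` that vanishes to the left of the support of `φ`. -/
def expPrimitive (a : ℝ) (φ : ℝ → ℝ) (s : ℝ) : ℝ :=
  ∫ x in (0 : ℝ)..s, φ x * Real.exp (a * (x - s))

lemma expPrimitive_eq (a : ℝ) (φ : ℝ → ℝ) (s : ℝ) :
    expPrimitive a φ s = Real.exp (-(a * s)) * ∫ x in (0 : ℝ)..s, φ x * Real.exp (a * x) := by
  rw [expPrimitive, ← intervalIntegral.integral_const_mul]
  congr 1
  funext x
  rw [mul_left_comm, ← Real.exp_add]
  congr 2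
  ring

lemma hasDerivAt_expPrimitive (a : ℝ) {φ : ℝ → ℝ} (hφ : Continuous φ) (s : ℝ) :
    HasDerivAt (expPrimitive a φ) (φ s - a * expPrimitive a φ s) s := by
  have hc : Continuous fun x => φ x * Real.exp (a * x) := by fun_prop
  have h1 : HasDerivAt (fun s => ∫ x in (0 : ℝ)..s, φ x * Real.exp (a * x))
      (φ s * Real.exp (a * s)) s :=
    intervalIntegral.integral_hasDerivAt_right (hc.intervalIntegrable _ _)
      (hc.stronglyMeasurableAtFilter _ _) hc.continuousAt
  have h2 : HasDerivAt (fun s => Real.exp (-(a * s))) (Real.exp (-(a * s)) * (-a)) s := by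
    have : HasDerivAt (fun s => -(a * s)) (-a) s := by
      simpa [neg_mul] using (hasDerivAt_id s).const_mul (-a)
    exact this.exp
  have h3 := h2.mul h1
  have e : expPrimitive a φ
      = fun s => Real.exp (-(a * s)) * ∫ x in (0 : ℝ)..s, φ x * Real.exp (a * x) :=
    funext (expPrimitive_eq a φ)
  rw [expPrimitive_eq, e]
  convert! h3 using 1
  have : Real.exp (-(a * s)) * Real.exp (a * s) = 1 := by rw [← Real.exp_add]; simp
  linear_combination (-φ s) * this

/-- Bootstrap in the equation Φ' = φ - aΦ: each order of smoothness of Φ yields the next. -/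
lemma contDiff_expPrimitive (a : ℝ) {φ : ℝ → ℝ} (hφ : ContDiff ℝ (⊤ : ℕ∞) φ) :
    ContDiff ℝ (⊤ : ℕ∞) (expPrimitive a φ) := by
  have hd := hasDerivAt_expPrimitive a hφ.continuous
  have hdiff : Differentiable ℝ (expPrimitive a φ) := fun s => (hd s).differentiableAt
  have hderiv : deriv (expPrimitive a φ) = fun s => φ s - a * expPrimitive a φ s :=
    funext fun s => (hd s).deriv
  rw [contDiff_infty]
  intro n
  induction n with
  | zero => exact contDiff_zero.2 hdiff.continuous
  | succ n ih =>
    rw [Nat.cast_succ, contDiff_succ_iff_deriv]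
    refine ⟨hdiff, by simp, ?_⟩
    rw [hderiv]
    exact (contDiff_infty.1 hφ n).sub (contDiff_const.mul ih)

lemma exists_pos_tsupport_subset {φ : ℝ → ℝ} (hc : HasCompactSupport φ)
    (hs : tsupport φ ⊆ Ioi 0) : ∃ ε > 0, tsupport φ ⊆ Ici ε := by
  rcases (tsupport φ).eq_empty_or_nonempty with h | h
  · exact ⟨1, one_pos, by rw [h]; exact empty_subset _⟩
  · obtain ⟨ε, hε, hmin⟩ := hc.isCompact.exists_isLeast h
    exact ⟨ε, hs hε, fun x hx => hmin hx⟩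

lemma expPrimitive_eq_zero {a ε : ℝ} {φ : ℝ → ℝ} (hε : 0 < ε) (hs : tsupport φ ⊆ Ici ε)
    {s : ℝ} (h : s < ε) : expPrimitive a φ s = 0 := by
  rw [expPrimitive]
  refine (intervalIntegral.integral_congr (g := fun _ => (0 : ℝ)) fun x hx => ?_).trans (by simp)
  have hx2 : x < ε := lt_of_le_of_lt hx.2 (max_lt hε h)
  have : φ x = 0 := by
    by_contra hne
    exact absurd (hs (subset_tsupport φ hne)) (not_le.2 hx2)
  simp [this]

lemma expPrimitive_bound {a : ℝ} {φ : ℝ → ℝ} (hφ : Continuous φ)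
    (hc : HasCompactSupport φ) :
    ∃ C, ∀ s, 0 < s → |expPrimitive a φ s| ≤ C * Real.exp (-(a * s)) := by
  have hcont : Continuous fun x => φ x * Real.exp (a * x) := by fun_prop
  have hint : Integrable fun x => φ x * Real.exp (a * x) :=
    hcont.integrable_of_hasCompactSupport hc.mul_right
  refine ⟨∫ x, ‖φ x * Real.exp (a * x)‖, fun s hs => ?_⟩
  rw [expPrimitive_eq, abs_mul, abs_of_pos (Real.exp_pos _), mul_comm]
  refine mul_le_mul_of_nonneg_right ?_ (Real.exp_pos _).le
  rw [intervalIntegral.integral_of_le hs.le]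
  exact (norm_integral_le_integral_norm (fun x => φ x * Real.exp (a * x))).trans
    (setIntegral_le_integral hint.norm (ae_of_all _ fun x => norm_nonneg _))

lemma memLp_expPrimitive {a : ℝ} (ha : 0 < a) {φ : ℝ → ℝ} (hφ : Continuous φ)
    (hc : HasCompactSupport φ) (hs : tsupport φ ⊆ Ioi 0) : MemLp (expPrimitive a φ) 2 volume := by
  obtain ⟨C, hC⟩ := expPrimitive_bound (a := a) hφ hc
  obtain ⟨ε, hε, hsε⟩ := exists_pos_tsupport_subset hc hs
  have hcont : Continuous (expPrimitive a φ) :=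
    continuous_iff_continuousAt.2 fun s => (hasDerivAt_expPrimitive a hφ s).continuousAt
  refine (memLp_expKernelFun ha 0).of_le_mul (c := C) hcont.aestronglyMeasurable ?_
  filter_upwards with s
  rw [expKernelFun]
  by_cases h : 0 < s
  · rw [indicator_of_mem (mem_Ioi.2 h), Complex.norm_real, Real.norm_eq_abs, Real.norm_eq_abs,
      abs_of_pos (Real.exp_pos _)]
    convert hC s h using 3
    ring
  · rw [expPrimitive_eq_zero hε hsε (by linarith), indicator_of_notMem (by simpa using h)]
    simp

lemma setIntegral_Ioi_eq {φ : ℝ → ℝ} (h : ∀ x ≤ 0, φ x = 0) (f : ℝ → ℂ) :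
    ∫ x in Ioi (0 : ℝ), φ x • f x = ∫ x, φ x • f x := by
  refine setIntegral_eq_integral_of_forall_compl_eq_zero fun x hx => ?_
  rw [h x (by simpa using hx), zero_smul]

lemma eq_zero_of_tsupport_subset {φ : ℝ → ℝ} (hs : tsupport φ ⊆ Ioi 0) : ∀ x ≤ 0, φ x = 0 := by
  intro x hx
  by_contra hne
  exact absurd (hs (subset_tsupport φ hne)) (not_lt.2 hx)

/-- A function with a weak derivative on `(0, ∞)` is given there by an exponential average of
itself and its derivative. -/
lemma HasWeakDerivOn.ae_eq_expTail {u v : L2} (h : HasWeakDerivOn (Ioi 0) u v) {a : ℝ}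
    (ha : 0 < a) : ∀ᵐ x : ℝ, x ∈ Ioi (0 : ℝ) → u x = expTail a x ((a : ℂ) • u - v : L2) := by
  set g : L2 := (a : ℂ) • u - v with hg
  have hTc : Continuous fun x => expTail a x g := continuous_expTail ha g
  have huloc : LocallyIntegrable (fun x => u x) := (Lp.memLp u).locallyIntegrable (by norm_num)
  have hloc : LocallyIntegrable (fun x => u x - expTail a x g) :=
    huloc.sub hTc.locallyIntegrable
  -- It suffices to pair with test functions φ. Fubini moves the average onto φ and produces Φ =
  -- `expPrimitive a φ`, so that ∫ φ · `expTail a x g` = ∫ Φ (a u - v). As Φ' = φ - aΦ, testing the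
  -- weak derivative with Φ gives the same value for ∫ φ u.
  have key := isOpen_Ioi.ae_eq_zero_of_integral_contDiff_smul_eq_zero (U := Ioi (0 : ℝ))
    (hloc.locallyIntegrableOn _) ?_
  · filter_upwards [key] with x hx hx0
    exact sub_eq_zero.1 (hx hx0)
  intro φ hφ hc hs
  have hφc := hφ.continuous
  have hΦs := contDiff_expPrimitive a hφ
  have hΦ2 := memLp_expPrimitive ha hφc hc hs
  have hderiv : deriv (expPrimitive a φ) = fun s => φ s - a * expPrimitive a φ s :=
    funext fun s => (hasDerivAt_expPrimitive a hφc s).deriv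
  have hφ2 : MemLp φ 2 volume := hφc.memLp_of_hasCompactSupport hc
  have hΦ2' : MemLp (deriv (expPrimitive a φ)) 2 volume := by
    rw [hderiv]
    exact hφ2.sub (hΦ2.const_mul a)
  obtain ⟨ε, hε, hsε⟩ := exists_pos_tsupport_subset hc hs
  have hΦ0 : ∀ s < ε, expPrimitive a φ s = 0 := fun s hs => expPrimitive_eq_zero hε hsε hs
  have hΦt : tsupport (expPrimitive a φ) ⊆ Ioi 0 := by
    have : tsupport (expPrimitive a φ) ⊆ Ici ε := by
      refine closure_minimal (fun s hs => ?_) isClosed_Ici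
      by_contra hlt
      exact hs (hΦ0 s (not_le.1 hlt))
    exact this.trans fun s hs => lt_of_lt_of_le hε hs
  have hw := h.integral_of_memLp hΦs hΦt hΦ2 hΦ2'
  have hF := integral_smul_expTail ha hφc hc g
  rw [setIntegral_Ioi_eq (eq_zero_of_tsupport_subset hs)] at hF
  have hF2 : ∫ x, φ x • expTail a x g = ∫ s, expPrimitive a φ s • g s := by
    rw [hF]
    exact setIntegral_Ioi_eq (fun s hs => hΦ0 s (lt_of_le_of_lt hs hε)) _
  have hΦu := integrable_smul_L2 hΦ2 u
  have hΦau : Integrable (fun x => a • expPrimitive a φ x • u x) := hΦu.smul a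
  have hΦv := integrable_smul_L2 hΦ2 v
  have hφu := integrable_smul_L2 hφ2 u
  have hF3 : ∫ s, expPrimitive a φ s • g s
      = a • (∫ s, expPrimitive a φ s • u s) - ∫ s, expPrimitive a φ s • v s := by
    rw [← integral_smul, ← integral_sub hΦau hΦv]
    refine integral_congr_ae ?_
    filter_upwards [Lp.coeFn_sub ((a : ℂ) • u) v, Lp.coeFn_smul (a : ℂ) u] with s h1 h2
    rw [hg, h1, Pi.sub_apply, h2, Pi.smul_apply, smul_sub]
    simp only [smul_eq_mul, Complex.real_smul]
    ring
  have hF4 : ∫ x, deriv (expPrimitive a φ) x • u x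
      = (∫ s, φ s • u s) - a • ∫ s, expPrimitive a φ s • u s := by
    rw [← integral_smul, ← integral_sub hφu hΦau]
    refine integral_congr_ae ?_
    filter_upwards with s
    rw [hderiv]
    simp only [Complex.real_smul]
    push_cast
    ring
  have hφT : Integrable fun x => φ x • expTail a x g :=
    (hφc.smul hTc).integrable_of_hasCompactSupport hc.smul_right
  simp_rw [smul_sub]
  rw [integral_sub hφu hφT, hF2, hF3]
  rw [hF4] at hw
  linear_combination hw

/-! ### The energy space -/

/-- `ψ ↦ ψ` as a bounded operator `Q → L²`. -/
def fnL : Q →L[ℂ] L2 := (WithLp.fstL 2 ℂ L2 L2) ∘L energySpace.subtypeL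

/-- `ψ ↦ ψ'` as a bounded operator `Q → L²`. -/
def dfnL : Q →L[ℂ] L2 := (WithLp.sndL 2 ℂ L2 L2) ∘L energySpace.subtypeL

lemma Q.fn_smul (c : ℂ) (ψ : Q) : (c • ψ).fn = c • ψ.fn := rfl
lemma Q.fn_sub (φ ψ : Q) : (φ - ψ).fn = φ.fn - ψ.fn := rfl

lemma Q.norm_sq (ψ : Q) : ‖ψ‖ ^ 2 = ‖ψ.fn‖ ^ 2 + ‖ψ.dfn‖ ^ 2 := by
  have := WithLp.prod_norm_sq_eq_of_L2 (ψ : WithLp 2 (L2 × L2))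
  exact this

lemma Q.weakDeriv_right (ψ : Q) : HasWeakDerivOn (Ioi 0) ψ.fn ψ.dfn := ψ.2.1
lemma Q.weakDeriv_left (ψ : Q) : HasWeakDerivOn (Iio 0) ψ.fn ψ.dfn := ψ.2.2

/-- Constructor for elements of the energy space. -/
def Q.mk' (u v : L2) (hr : HasWeakDerivOn (Ioi 0) u v) (hl : HasWeakDerivOn (Iio 0) u v) : Q :=
  ⟨WithLp.toLp 2 (u, v), hr, hl⟩

lemma Q.ext' {φ ψ : Q} (h : φ.fn = ψ.fn) (h' : φ.dfn = ψ.dfn) : φ = ψ := by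
  apply Subtype.ext
  apply (WithLp.equiv 2 (L2 × L2)).injective
  exact Prod.ext h h'

/-! ### Reflection -/

/-- `u ↦ u(-·)` on `L²`. -/
def reflL2 : L2 →ₗᵢ[ℂ] L2 :=
  Lp.compMeasurePreservingₗᵢ ℂ (Neg.neg : ℝ → ℝ) (Measure.measurePreserving_neg volume)

lemma reflL2_coe (u : L2) : reflL2 u =ᵐ[volume] fun x => u (-x) :=
  Lp.coeFn_compMeasurePreserving u (Measure.measurePreserving_neg volume)

lemma reflL2_reflL2 (u : L2) : reflL2 (reflL2 u) = u := by
  apply Lp.ext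
  have h := (Measure.measurePreserving_neg (volume : Measure ℝ)).quasiMeasurePreserving.ae
    (reflL2_coe u)
  filter_upwards [reflL2_coe (reflL2 u), h] with x h1 h2
  rw [h1, h2, neg_neg]

lemma integral_smul_reflL2 (φ : ℝ → ℝ) (u : L2) :
    ∫ x, φ x • reflL2 u x = ∫ x, φ (-x) • u x := by
  rw [← integral_neg_eq_self (fun x => φ (-x) • u x)]
  refine integral_congr_ae ?_
  filter_upwards [reflL2_coe u] with x hx
  rw [hx, neg_neg]

lemma HasWeakDerivOn.refl {Ω Ω' : Set ℝ} {u v : L2} (h : HasWeakDerivOn Ω u v)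
    (hΩ : ∀ x ∈ Ω', -x ∈ Ω) : HasWeakDerivOn Ω' (reflL2 u) (-reflL2 v) := by
  intro φ hφ hc hs
  have hd : ∀ x, deriv (fun y => φ (-y)) x = - deriv φ (-x) := fun x => deriv_comp_neg _ _
  have h1 := h (fun x => φ (-x)) (hφ.comp contDiff_neg)
    (hc.comp_homeomorph (Homeomorph.neg ℝ)) ?_
  · rw [integral_smul_reflL2]
    have e : ∫ x, φ x • (-reflL2 v : L2) x = - ∫ x, φ x • reflL2 v x := by
      rw [← integral_neg]
      refine integral_congr_ae ?_
      filter_upwards [Lp.coeFn_neg (reflL2 v)] with x hx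
      rw [hx, Pi.neg_apply, smul_neg]
    rw [e, integral_smul_reflL2]
    simp_rw [hd, neg_smul] at h1
    rw [integral_neg] at h1
    rw [neg_neg, ← neg_inj, h1]
  · have := tsupport_comp_eq_preimage φ (Homeomorph.neg ℝ)
    intro x hx
    have hx' : -x ∈ tsupport φ := by
      have h2 : x ∈ (Homeomorph.neg ℝ) ⁻¹' tsupport φ := by
        rw [← this]; exact hx
      exact h2
    simpa using hΩ _ (hs hx')

/-- Reflection `ψ ↦ ψ(-·)` on the energy space. -/
def reflect : Q →ₗ[ℂ] Q where
  toFun ψ := Q.mk' (reflL2 ψ.fn) (-reflL2 ψ.dfn)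
    (ψ.weakDeriv_left.refl fun x hx => by simpa using hx)
    (ψ.weakDeriv_right.refl fun x hx => by simpa using hx)
  map_add' φ ψ := by
    refine Q.ext' (map_add reflL2 _ _) ?_
    change - reflL2 (φ.dfn + ψ.dfn) = - reflL2 φ.dfn + - reflL2 ψ.dfn
    rw [map_add, neg_add]
  map_smul' c ψ := by
    refine Q.ext' (map_smul reflL2 c _) ?_
    change - reflL2 (c • ψ.dfn) = c • - reflL2 ψ.dfn
    rw [map_smul, smul_neg]

lemma reflect_fn (ψ : Q) : (reflect ψ).fn = reflL2 ψ.fn := rfl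
lemma reflect_dfn (ψ : Q) : (reflect ψ).dfn = - reflL2 ψ.dfn := rfl

lemma reflect_reflect (ψ : Q) : reflect (reflect ψ) = ψ := by
  refine Q.ext' (reflL2_reflL2 _) ?_
  change - reflL2 (- reflL2 ψ.dfn) = ψ.dfn
  rw [map_neg, reflL2_reflL2, neg_neg]

lemma norm_reflect (ψ : Q) : ‖reflect ψ‖ = ‖ψ‖ := by
  rw [← sq_eq_sq₀ (norm_nonneg _) (norm_nonneg _), Q.norm_sq, Q.norm_sq, reflect_fn, reflect_dfn,
    norm_neg, reflL2.norm_map, reflL2.norm_map]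

/-- Reflection as a bounded operator. -/
def reflectL : Q →L[ℂ] Q := reflect.mkContinuous 1 fun ψ => by rw [one_mul, norm_reflect]

/-! ### Point evaluation and boundary values -/

/-- The value at `x ≥ 0` of the continuous representative on the right half-line. -/
def rightEval {a : ℝ} (ha : 0 < a) (x : ℝ) : Q →L[ℂ] ℂ :=
  innerSL ℂ (expKernel ha x) ∘L ((a : ℂ) • fnL - dfnL)

lemma rightEval_apply {a : ℝ} (ha : 0 < a) (x : ℝ) (ψ : Q) :
    rightEval ha x ψ = expTail a x ((a : ℂ) • ψ.fn - ψ.dfn : L2) :=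
  inner_expKernel ha x _

lemma continuous_rightEval {a : ℝ} (ha : 0 < a) (ψ : Q) :
    Continuous fun x => rightEval ha x ψ := by
  simp_rw [rightEval_apply]
  exact continuous_expTail ha _

lemma ae_eq_rightEval {a : ℝ} (ha : 0 < a) (ψ : Q) :
    ∀ᵐ x : ℝ, x ∈ Ioi (0 : ℝ) → ψ.fn x = rightEval ha x ψ := by
  filter_upwards [ψ.weakDeriv_right.ae_eq_expTail ha] with x hx h
  rw [hx h, rightEval_apply]

/-- Reflection transfers the representation formula to the left half-line, so the analysis need only
be done on the right. -/
lemma ae_eq_leftEval {a : ℝ} (ha : 0 < a) (ψ : Q) :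
    ∀ᵐ x : ℝ, x ∈ Iio (0 : ℝ) → ψ.fn x = rightEval ha (-x) (reflect ψ) := by
  have hq := (Measure.measurePreserving_neg (volume : Measure ℝ)).quasiMeasurePreserving
  filter_upwards [hq.ae (ae_eq_rightEval ha (reflect ψ)), hq.ae (reflL2_coe ψ.fn)] with x h1 h2 hx
  rw [← h1 (by simpa using hx), reflect_fn, h2, neg_neg]

/-- Cauchy–Schwarz against a kernel of squared norm 1/(2a), then (p + q)² ≤ 2(p² + q²). The
parameter a stays free because coercivity has to balance the two terms. -/
lemma norm_rightEval_sq_le {a : ℝ} (ha : 0 < a) (x : ℝ) (ψ : Q) :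
    ‖rightEval ha x ψ‖ ^ 2 ≤ a * ‖ψ.fn‖ ^ 2 + a⁻¹ * ‖ψ.dfn‖ ^ 2 := by
  have h1 : ‖rightEval ha x ψ‖ ≤ ‖expKernel ha x‖ * ‖(a : ℂ) • ψ.fn - ψ.dfn‖ :=
    norm_inner_le_norm (𝕜 := ℂ) (expKernel ha x) ((a : ℂ) • ψ.fn - ψ.dfn)
  have h2 : ‖(a : ℂ) • ψ.fn - ψ.dfn‖ ≤ a * ‖ψ.fn‖ + ‖ψ.dfn‖ := by
    refine (norm_sub_le _ _).trans_eq ?_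
    rw [norm_smul, Complex.norm_real, Real.norm_of_nonneg ha.le]
  have h3 : ‖rightEval ha x ψ‖ ^ 2 ≤ 1 / (2 * a) * (a * ‖ψ.fn‖ + ‖ψ.dfn‖) ^ 2 := by
    rw [← norm_expKernel_sq ha x, ← mul_pow]
    exact pow_le_pow_left₀ (norm_nonneg _)
      (h1.trans (mul_le_mul_of_nonneg_left h2 (norm_nonneg _))) 2
  refine h3.trans ?_
  have e : a * ‖ψ.fn‖ ^ 2 + a⁻¹ * ‖ψ.dfn‖ ^ 2 - 1 / (2 * a) * (a * ‖ψ.fn‖ + ‖ψ.dfn‖) ^ 2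
      = 1 / (2 * a) * (a * ‖ψ.fn‖ - ‖ψ.dfn‖) ^ 2 := by
    field_simp
    ring
  have : 0 ≤ 1 / (2 * a) * (a * ‖ψ.fn‖ - ‖ψ.dfn‖) ^ 2 := by positivity
  linarith

/-- Nontriviality of this filter makes essential limits unique, so that `limUnder` in the boundary
values really computes them. -/
instance nhdsGT_inf_ae_neBot : NeBot (𝓝[>] (0 : ℝ) ⊓ ae volume) := by
  rw [inf_neBot_iff]
  intro s hs t ht
  obtain ⟨ε, hε, hsub⟩ := mem_nhdsGT_iff_exists_Ioo_subset.1 hs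
  by_contra hne
  rw [not_nonempty_iff_eq_empty] at hne
  have h0 : volume (Ioo (0 : ℝ) ε) = 0 := by
    refine measure_mono_null (t := tᶜ) (fun x hx hxt => ?_) ht
    have : x ∈ s ∩ t := ⟨hsub hx, hxt⟩
    rw [hne] at this
    exact this
  rw [Real.volume_Ioo] at h0
  simp at h0
  exact absurd hε (not_lt.2 h0)

instance nhdsLT_inf_ae_neBot : NeBot (𝓝[<] (0 : ℝ) ⊓ ae volume) := by
  rw [inf_neBot_iff]
  intro s hs t ht
  obtain ⟨ε, hε, hsub⟩ := mem_nhdsLT_iff_exists_Ioo_subset.1 hs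
  by_contra hne
  rw [not_nonempty_iff_eq_empty] at hne
  have h0 : volume (Ioo ε (0 : ℝ)) = 0 := by
    refine measure_mono_null (t := tᶜ) (fun x hx hxt => ?_) ht
    have : x ∈ s ∩ t := ⟨hsub hx, hxt⟩
    rw [hne] at this
    exact this
  rw [Real.volume_Ioo] at h0
  simp at h0
  exact absurd hε (not_lt.2 h0)

lemma limUnder_inf_ae_eq {l : Filter ℝ} [NeBot (l ⊓ ae volume)] {S : Set ℝ} (hS : S ∈ l)
    {u F : ℝ → ℂ} {c : ℂ} (h : ∀ᵐ x : ℝ, x ∈ S → u x = F x) (hF : Tendsto F l (𝓝 c)) :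
    limUnder (l ⊓ ae volume) u = c := by
  refine Tendsto.limUnder_eq ?_
  refine (hF.mono_left inf_le_left).congr' ?_
  have h1 : ∀ᶠ x in l ⊓ ae volume, x ∈ S := mem_inf_of_left hS
  have h2 : ∀ᶠ x in l ⊓ ae volume, x ∈ S → u x = F x := mem_inf_of_right h
  filter_upwards [h1, h2] with x hx hx2
  exact (hx2 hx).symm

lemma Q.rightValue_eq_of_ae {ψ : Q} {F : ℝ → ℂ} {c : ℂ}
    (h : ∀ᵐ x : ℝ, x ∈ Ioi (0 : ℝ) → ψ.fn x = F x) (hF : Tendsto F (𝓝[>] 0) (𝓝 c)) :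
    ψ.rightValue = c :=
  limUnder_inf_ae_eq self_mem_nhdsWithin h hF

lemma Q.leftValue_eq_of_ae {ψ : Q} {F : ℝ → ℂ} {c : ℂ}
    (h : ∀ᵐ x : ℝ, x ∈ Iio (0 : ℝ) → ψ.fn x = F x) (hF : Tendsto F (𝓝[<] 0) (𝓝 c)) :
    ψ.leftValue = c :=
  limUnder_inf_ae_eq self_mem_nhdsWithin h hF

lemma Q.rightValue_eq {a : ℝ} (ha : 0 < a) (ψ : Q) : ψ.rightValue = rightEval ha 0 ψ :=
  Q.rightValue_eq_of_ae (ae_eq_rightEval ha ψ)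
    ((continuous_rightEval ha ψ).continuousAt.mono_left nhdsWithin_le_nhds)

lemma Q.leftValue_eq {a : ℝ} (ha : 0 < a) (ψ : Q) : ψ.leftValue = rightEval ha 0 (reflect ψ) := by
  refine Q.leftValue_eq_of_ae (ae_eq_leftEval ha ψ) ?_
  have h : Continuous fun x => rightEval ha (-x) (reflect ψ) :=
    (continuous_rightEval ha (reflect ψ)).comp continuous_neg
  have := h.tendsto 0
  simp only [neg_zero] at this
  exact this.mono_left nhdsWithin_le_nhds

lemma Q.rightValue_reflect (ψ : Q) : (reflect ψ).rightValue = ψ.leftValue := by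
  rw [Q.rightValue_eq one_pos, Q.leftValue_eq one_pos]

lemma Q.leftValue_reflect (ψ : Q) : (reflect ψ).leftValue = ψ.rightValue := by
  rw [← Q.rightValue_reflect, reflect_reflect]

/-- The value at `x ≠ 0` of the continuous representative. -/
def evalL (x : ℝ) : Q →L[ℂ] ℂ :=
  if 0 < x then rightEval one_pos x else rightEval one_pos (-x) ∘L reflectL

lemma evalL_of_pos {x : ℝ} (hx : 0 < x) (ψ : Q) : evalL x ψ = rightEval one_pos x ψ := by
  rw [evalL, if_pos hx]

lemma evalL_of_neg {x : ℝ} (hx : x < 0) (ψ : Q) :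
    evalL x ψ = rightEval one_pos (-x) (reflect ψ) := by
  rw [evalL, if_neg (not_lt.2 hx.le)]
  rfl

lemma ae_eq_evalL (ψ : Q) : ∀ᵐ x : ℝ, ψ.fn x = evalL x ψ := by
  have h0 : ∀ᵐ x : ℝ, x ≠ 0 := by
    simp [ae_iff]
  filter_upwards [ae_eq_rightEval one_pos ψ, ae_eq_leftEval one_pos ψ, h0] with x h1 h2 h3
  rcases lt_or_gt_of_ne h3 with h | h
  · rw [evalL_of_neg h, h2 h]
  · rw [evalL_of_pos h, h1 h]

lemma continuousAt_evalL (ψ : Q) {x : ℝ} (hx : x ≠ 0) :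
    ContinuousAt (fun y => evalL y ψ) x := by
  rcases lt_or_gt_of_ne hx with h | h
  · have hc : ContinuousAt (fun y => rightEval one_pos (-y) (reflect ψ)) x :=
      ((continuous_rightEval one_pos (reflect ψ)).comp continuous_neg).continuousAt
    refine hc.congr ?_
    filter_upwards [Iio_mem_nhds h] with y hy
    rw [evalL_of_neg hy]
  · refine (continuous_rightEval one_pos ψ).continuousAt.congr ?_
    filter_upwards [Ioi_mem_nhds h] with y hy
    rw [evalL_of_pos hy]

lemma norm_rightEval_one_le (x : ℝ) (ψ : Q) : ‖rightEval one_pos x ψ‖ ≤ ‖ψ‖ := by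
  have := norm_rightEval_sq_le one_pos x ψ
  rw [inv_one, one_mul, one_mul, ← Q.norm_sq] at this
  exact le_of_sq_le_sq this (norm_nonneg _)

lemma ae_norm_fn_le (ψ : Q) : ∀ᵐ x : ℝ, ‖ψ.fn x‖ ≤ ‖ψ‖ := by
  filter_upwards [ae_eq_evalL ψ] with x hx
  rw [hx, evalL]
  split_ifs
  · exact norm_rightEval_one_le _ _
  · exact (norm_rightEval_one_le _ _).trans_eq (norm_reflect ψ)

/-- The boundary value `ψ(0+)` as a bounded functional. -/
def rightValueL : Q →L[ℂ] ℂ := rightEval one_pos 0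

/-- The boundary value `ψ(0-)` as a bounded functional. -/
def leftValueL : Q →L[ℂ] ℂ := rightEval one_pos 0 ∘L reflectL

lemma rightValueL_apply (ψ : Q) : rightValueL ψ = ψ.rightValue := (Q.rightValue_eq one_pos ψ).symm
lemma leftValueL_apply (ψ : Q) : leftValueL ψ = ψ.leftValue := (Q.leftValue_eq one_pos ψ).symm

/-! ### Restriction to a half-line -/

/-- Multiplication by the indicator function of `s`. -/
def restrL2 {s : Set ℝ} (hs : MeasurableSet s) (u : L2) : L2 := ((Lp.memLp u).indicator hs).toLp _

lemma restrL2_coe {s : Set ℝ} (hs : MeasurableSet s) (u : L2) :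
    restrL2 hs u =ᵐ[volume] s.indicator u :=
  ((Lp.memLp u).indicator hs).coeFn_toLp

lemma norm_restrL2_sq {s : Set ℝ} (hs : MeasurableSet s) (u : L2) :
    ‖restrL2 hs u‖ ^ 2 = ∫ x in s, ‖u x‖ ^ 2 := by
  rw [L2_norm_sq, ← integral_indicator hs]
  refine integral_congr_ae ?_
  filter_upwards [restrL2_coe hs u] with x hx
  rw [hx]
  by_cases h : x ∈ s
  · rw [indicator_of_mem h, indicator_of_mem h]
  · rw [indicator_of_notMem h, indicator_of_notMem h]; simp

/-- A test function supported in Ω does not see a cut outside Ω. As the origin belongs to neither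
open half-line, cutting there stays inside Q. -/
lemma HasWeakDerivOn.restr_of_subset {Ω s : Set ℝ} (hs : MeasurableSet s) {u v : L2}
    (h : HasWeakDerivOn Ω u v) (hΩ : Ω ⊆ s) :
    HasWeakDerivOn Ω (restrL2 hs u) (restrL2 hs v) := by
  intro φ hφ hc ht
  have key : ∀ (ξ : ℝ → ℝ) (w : L2), Function.support ξ ⊆ Ω →
      ∫ x, ξ x • restrL2 hs w x = ∫ x, ξ x • w x := by
    intro ξ w hξ
    refine integral_congr_ae ?_
    filter_upwards [restrL2_coe hs w] with x hx
    rw [hx]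
    by_cases h0 : ξ x = 0
    · simp [h0]
    · rw [indicator_of_mem (hΩ (hξ h0))]
  rw [key _ _ ((support_deriv_subset).trans ht), key _ _ ((subset_tsupport φ).trans ht)]
  exact h φ hφ hc ht

lemma hasWeakDerivOn_restr_of_disjoint {Ω s : Set ℝ} (hs : MeasurableSet s) (u v : L2)
    (hΩ : Disjoint Ω s) : HasWeakDerivOn Ω (restrL2 hs u) (restrL2 hs v) := by
  intro φ hφ hc ht
  have key : ∀ (ξ : ℝ → ℝ) (w : L2), Function.support ξ ⊆ Ω →
      ∫ x, ξ x • restrL2 hs w x = 0 := by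
    intro ξ w hξ
    refine integral_eq_zero_of_ae ?_
    filter_upwards [restrL2_coe hs w] with x hx
    rw [hx]
    by_cases h0 : ξ x = 0
    · simp [h0]
    · rw [indicator_of_notMem (disjoint_left.1 hΩ (hξ h0))]
      simp
  rw [key _ _ ((support_deriv_subset).trans ht), key _ _ ((subset_tsupport φ).trans ht), neg_zero]

lemma measurableSet_right : MeasurableSet (Ioi (0 : ℝ)) := measurableSet_Ioi

lemma measurableSet_left : MeasurableSet (Iio (0 : ℝ)) := measurableSet_Iio

lemma disjoint_Iio_Ioi : Disjoint (Iio (0 : ℝ)) (Ioi 0) :=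
  disjoint_left.2 fun _ h h' => lt_asymm (mem_Iio.1 h) (mem_Ioi.1 h')

/-- The part of `ψ` on the right half-line. -/
def Q.rightPart (ψ : Q) : Q :=
  Q.mk' (restrL2 measurableSet_right ψ.fn) (restrL2 measurableSet_right ψ.dfn)
    (ψ.weakDeriv_right.restr_of_subset _ subset_rfl)
    (hasWeakDerivOn_restr_of_disjoint _ _ _ disjoint_Iio_Ioi)

/-- The part of `ψ` on the left half-line. -/
def Q.leftPart (ψ : Q) : Q :=
  Q.mk' (restrL2 measurableSet_left ψ.fn) (restrL2 measurableSet_left ψ.dfn)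
    (hasWeakDerivOn_restr_of_disjoint _ _ _ disjoint_Iio_Ioi.symm)
    (ψ.weakDeriv_left.restr_of_subset _ subset_rfl)

lemma Q.rightPart_fn (ψ : Q) : ψ.rightPart.fn = restrL2 measurableSet_right ψ.fn := rfl
lemma Q.rightPart_dfn (ψ : Q) : ψ.rightPart.dfn = restrL2 measurableSet_right ψ.dfn := rfl
lemma Q.leftPart_fn (ψ : Q) : ψ.leftPart.fn = restrL2 measurableSet_left ψ.fn := rfl
lemma Q.leftPart_dfn (ψ : Q) : ψ.leftPart.dfn = restrL2 measurableSet_left ψ.dfn := rfl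

lemma Q.rightValue_rightPart (ψ : Q) : ψ.rightPart.rightValue = ψ.rightValue := by
  rw [Q.rightValue_eq one_pos ψ]
  refine Q.rightValue_eq_of_ae ?_
    ((continuous_rightEval one_pos ψ).continuousAt.mono_left nhdsWithin_le_nhds)
  filter_upwards [ae_eq_rightEval one_pos ψ, restrL2_coe measurableSet_right ψ.fn] with x h1 h2 hx
  rw [Q.rightPart_fn, h2, indicator_of_mem hx, h1 hx]

lemma Q.leftValue_rightPart (ψ : Q) : ψ.rightPart.leftValue = 0 := by
  refine Q.leftValue_eq_of_ae (F := fun _ => 0) ?_ tendsto_const_nhds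
  filter_upwards [restrL2_coe measurableSet_right ψ.fn] with x h2 hx
  rw [Q.rightPart_fn, h2, indicator_of_notMem (disjoint_left.1 disjoint_Iio_Ioi hx)]

lemma Q.leftValue_leftPart (ψ : Q) : ψ.leftPart.leftValue = ψ.leftValue := by
  rw [Q.leftValue_eq one_pos ψ]
  have h := ((continuous_rightEval one_pos (reflect ψ)).comp continuous_neg).tendsto 0
  simp only [Function.comp_apply, neg_zero] at h
  refine Q.leftValue_eq_of_ae ?_ (h.mono_left nhdsWithin_le_nhds)
  filter_upwards [ae_eq_leftEval one_pos ψ, restrL2_coe measurableSet_left ψ.fn] with x h1 h2 hx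
  rw [Q.leftPart_fn, h2, indicator_of_mem hx, h1 hx]
  rfl

lemma Q.rightValue_leftPart (ψ : Q) : ψ.leftPart.rightValue = 0 := by
  refine Q.rightValue_eq_of_ae (F := fun _ => 0) ?_ tendsto_const_nhds
  filter_upwards [restrL2_coe measurableSet_left ψ.fn] with x h2 hx
  rw [Q.leftPart_fn, h2, indicator_of_notMem (disjoint_right.1 disjoint_Iio_Ioi hx)]

lemma integral_Iio_add_Ioi {f : ℝ → ℂ} (hf : Integrable f) :
    (∫ x in Iio 0, f x) + ∫ x in Ioi 0, f x = ∫ x, f x := by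
  rw [← integral_Iic_eq_integral_Iio]
  exact intervalIntegral.integral_Iic_add_Ioi hf.integrableOn hf.integrableOn

lemma integral_Iio_add_Ioi_real {f : ℝ → ℝ} (hf : Integrable f) :
    (∫ x in Iio 0, f x) + ∫ x in Ioi 0, f x = ∫ x, f x := by
  rw [← integral_Iic_eq_integral_Iio]
  exact intervalIntegral.integral_Iic_add_Ioi hf.integrableOn hf.integrableOn

lemma norm_restrL2_add (u : L2) : ‖restrL2 measurableSet_left u‖ ^ 2 +
    ‖restrL2 measurableSet_right u‖ ^ 2 = ‖u‖ ^ 2 := by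
  rw [norm_restrL2_sq, norm_restrL2_sq, L2_norm_sq]
  exact integral_Iio_add_Ioi_real (L2_integrable_sq u)

/-- The trace inequality for the two boundary values together. -/
lemma norm_traces_sq_le {a : ℝ} (ha : 0 < a) (ψ : Q) :
    ‖ψ.rightValue‖ ^ 2 + ‖ψ.leftValue‖ ^ 2 ≤ a * ‖ψ.fn‖ ^ 2 + a⁻¹ * ‖ψ.dfn‖ ^ 2 := by
  -- Each trace is estimated by the norms over its own half-line only, so the two bounds add up
  -- without doubling.
  have h1 := norm_rightEval_sq_le ha 0 ψ.rightPart
  rw [← Q.rightValue_eq, Q.rightValue_rightPart, Q.rightPart_fn, Q.rightPart_dfn] at h1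
  have h2 := norm_rightEval_sq_le ha 0 (reflect ψ.leftPart)
  rw [← Q.leftValue_eq, Q.leftValue_leftPart, reflect_fn, reflect_dfn, norm_neg,
    reflL2.norm_map, reflL2.norm_map, Q.leftPart_fn, Q.leftPart_dfn] at h2
  rw [← norm_restrL2_add ψ.fn, ← norm_restrL2_add ψ.dfn]
  linarith

/-- From |p - q|² ≤ 2(|p|² + |q|²). Equality holds for sgn(x) e^{-a|x|}, and this constant produces
the threshold 4/γ². -/
lemma norm_jump_sq_le {a : ℝ} (ha : 0 < a) (ψ : Q) :
    ‖ψ.rightValue - ψ.leftValue‖ ^ 2 ≤ 2 * (a * ‖ψ.fn‖ ^ 2 + a⁻¹ * ‖ψ.dfn‖ ^ 2) := by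
  have h1 := norm_traces_sq_le ha ψ
  have h2 : ‖ψ.rightValue - ψ.leftValue‖ ^ 2 ≤ (‖ψ.rightValue‖ + ‖ψ.leftValue‖) ^ 2 :=
    pow_le_pow_left₀ (norm_nonneg _) (norm_sub_le _ _) 2
  nlinarith [sq_nonneg (‖ψ.rightValue‖ - ‖ψ.leftValue‖)]

/-! ### Functions with prescribed boundary values -/

lemma hasWeakDerivOn_expKernel :
    HasWeakDerivOn (Ioi 0) (expKernel one_pos 0) (-expKernel one_pos 0) := by
  intro φ hφ hc hs
  have hφ0 := eq_zero_of_tsupport_subset hs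
  have hφ'0 : ∀ x ≤ 0, deriv φ x = 0 := fun x hx => by
    by_contra hne
    exact absurd (hs (support_deriv_subset hne)) (not_lt.2 hx)
  have hcoe := (memLp_expKernelFun one_pos 0).coeFn_toLp
  have e1 : ∫ x, deriv φ x • expKernel one_pos 0 x
      = ∫ x, ((deriv φ x * Real.exp (-x) : ℝ) : ℂ) := by
    refine integral_congr_ae ?_
    filter_upwards [hcoe] with x hx
    rw [expKernel, hx, expKernelFun]
    by_cases h : 0 < x
    · rw [indicator_of_mem (mem_Ioi.2 h), Complex.real_smul]
      push_cast
      simp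
    · rw [hφ'0 x (not_lt.1 h)]; simp
  have e2 : ∫ x, φ x • (-expKernel one_pos 0 : L2) x
      = ∫ x, ((-(φ x * Real.exp (-x)) : ℝ) : ℂ) := by
    refine integral_congr_ae ?_
    filter_upwards [hcoe, Lp.coeFn_neg (expKernel one_pos 0)] with x hx h2
    rw [h2, Pi.neg_apply, expKernel, hx, expKernelFun]
    by_cases h : 0 < x
    · rw [indicator_of_mem (mem_Ioi.2 h), smul_neg, Complex.real_smul]
      push_cast
      simp
    · rw [hφ0 x (not_lt.1 h)]; simp
  rw [e1, e2, integral_complex_ofReal, integral_complex_ofReal, ← Complex.ofReal_neg, integral_neg,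
    neg_neg]
  congr 1
  have hφc := hφ.continuous
  have hφ'c : Continuous (deriv φ) := hφ.continuous_deriv (by simp)
  have hexp : Continuous fun x : ℝ => Real.exp (-x) := by fun_prop
  have i1 : Integrable fun x => φ x * Real.exp (-x) :=
    (hφc.mul hexp).integrable_of_hasCompactSupport hc.mul_right
  have i2 : Integrable fun x => deriv φ x * Real.exp (-x) :=
    (hφ'c.mul hexp).integrable_of_hasCompactSupport hc.deriv.mul_right
  have hder : ∀ x, HasDerivAt (fun x => φ x * Real.exp (-x))
      (deriv φ x * Real.exp (-x) - φ x * Real.exp (-x)) x := by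
    intro x
    have h1 : HasDerivAt φ (deriv φ x) x := (hφ.differentiable (by simp) x).hasDerivAt
    have h2 : HasDerivAt (fun x : ℝ => Real.exp (-x)) (Real.exp (-x) * (-1)) x :=
      (hasDerivAt_neg x).exp
    convert! h1.mul h2 using 1
    ring
  have h0 := integral_eq_zero_of_hasDerivAt_of_integrable hder (i2.sub i1) i1
  rw [integral_sub i2 i1] at h0
  linarith

lemma restrL2_expKernel : restrL2 measurableSet_right (expKernel one_pos 0) = expKernel one_pos 0 := by
  apply Lp.ext
  filter_upwards [restrL2_coe measurableSet_right (expKernel one_pos 0),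
    (memLp_expKernelFun one_pos 0).coeFn_toLp] with x h1 h2
  have h3 : expKernel one_pos 0 x = expKernelFun 1 0 x := h2
  rw [h1]
  by_cases h : x ∈ Ioi (0 : ℝ)
  · rw [indicator_of_mem h]
  · rw [indicator_of_notMem h, h3, expKernelFun, indicator_of_notMem h]

lemma restrL2_neg {s : Set ℝ} (hs : MeasurableSet s) (u : L2) :
    restrL2 hs (-u) = - restrL2 hs u := by
  apply Lp.ext
  filter_upwards [restrL2_coe hs (-u), restrL2_coe hs u, Lp.coeFn_neg (restrL2 hs u),
    Lp.coeFn_neg u] with x h1 h2 h3 h4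
  rw [h1, h3, Pi.neg_apply, h2]
  by_cases h : x ∈ s
  · rw [indicator_of_mem h, indicator_of_mem h, h4, Pi.neg_apply]
  · rw [indicator_of_notMem h, indicator_of_notMem h, neg_zero]

/-- The function equal to `e^{-x}` on the right half-line and `0` on the left one. -/
def rightUnit : Q :=
  Q.mk' (expKernel one_pos 0) (-expKernel one_pos 0) hasWeakDerivOn_expKernel (by
    have h := hasWeakDerivOn_restr_of_disjoint (Ω := Iio 0) measurableSet_right
      (expKernel one_pos 0) (-expKernel one_pos 0) disjoint_Iio_Ioi
    rwa [restrL2_neg, restrL2_expKernel] at h)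

lemma rightUnit_rightPart : rightUnit.rightPart = rightUnit :=
  Q.ext' restrL2_expKernel (by
    change restrL2 measurableSet_right (-expKernel one_pos 0) = -expKernel one_pos 0
    rw [restrL2_neg, restrL2_expKernel])

lemma rightValue_rightUnit : rightUnit.rightValue = 1 := by
  rw [Q.rightValue_eq one_pos]
  -- With k the kernel and derivative -k, the representation formula reads ⟨k, k + k⟩ = 2‖k‖² = 1.
  change inner ℂ (expKernel one_pos 0)
    (((1 : ℝ) : ℂ) • expKernel one_pos 0 - (-expKernel one_pos 0)) = 1
  rw [Complex.ofReal_one, one_smul, sub_neg_eq_add, inner_add_right, inner_self_eq_norm_sq_to_K]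
  have := norm_expKernel_sq one_pos 0
  have h2 : ((‖expKernel one_pos 0‖ : ℝ) : ℂ) ^ 2 = ((1 / (2 * 1) : ℝ) : ℂ) := by
    rw [← this]; push_cast; rfl
  refine (congrArg₂ (· + ·) h2 h2).trans ?_
  push_cast
  norm_num

lemma leftValue_rightUnit : rightUnit.leftValue = 0 := by
  rw [← rightUnit_rightPart, Q.leftValue_rightPart]

/-- The function equal to `e^{x}` on the left half-line and `0` on the right one. -/
def leftUnit : Q := reflect rightUnit

lemma rightValue_leftUnit : leftUnit.rightValue = 0 := by
  rw [leftUnit, Q.rightValue_reflect, leftValue_rightUnit]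

lemma leftValue_leftUnit : leftUnit.leftValue = 1 := by
  rw [leftUnit, Q.leftValue_reflect, rightValue_rightUnit]

/-! ### Functions without a jump, and translation -/

/-- Because (φ e^x)' = (φ' + φ) e^x. The term at the lower endpoint, paired with ψ - ψ', becomes the
boundary term φ(0) ψ(0+) in the integration by parts. -/
lemma expPrimitive_deriv_add {φ : ℝ → ℝ} (hφ : ContDiff ℝ (⊤ : ℕ∞) φ) (s : ℝ) :
    expPrimitive 1 (fun x => deriv φ x + φ x) s = φ s - φ 0 * Real.exp (-s) := by
  have hφc := hφ.continuous
  have hφ'c : Continuous (deriv φ) := hφ.continuous_deriv (by simp)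
  rw [expPrimitive]
  have hder : ∀ x ∈ uIcc 0 s, HasDerivAt (fun x => φ x * Real.exp (1 * (x - s)))
      ((deriv φ x + φ x) * Real.exp (1 * (x - s))) x := by
    intro x _
    have h1 : HasDerivAt φ (deriv φ x) x := (hφ.differentiable (by simp) x).hasDerivAt
    have h2 : HasDerivAt (fun x : ℝ => Real.exp (1 * (x - s))) (Real.exp (1 * (x - s)) * 1) x := by
      have : HasDerivAt (fun x : ℝ => 1 * (x - s)) 1 x := by
        simpa using ((hasDerivAt_id x).sub_const s).const_mul 1
      exact this.exp
    convert! h1.mul h2 using 1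
    ring
  rw [intervalIntegral.integral_eq_sub_of_hasDerivAt hder]
  · simp
  · have : Continuous fun x => (deriv φ x + φ x) * Real.exp (1 * (x - s)) := by fun_prop
    exact this.intervalIntegrable _ _

/-- Integration by parts on the right half-line. -/
lemma Q.integral_Ioi_deriv_smul (ψ : Q) {φ : ℝ → ℝ} (hφ : ContDiff ℝ (⊤ : ℕ∞) φ)
    (hc : HasCompactSupport φ) :
    ∫ x in Ioi 0, deriv φ x • ψ.fn x
      = - (∫ x in Ioi 0, φ x • ψ.dfn x) - φ 0 • ψ.rightValue := by
  have hφc := hφ.continuous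
  have hφ'c : Continuous (deriv φ) := hφ.continuous_deriv (by simp)
  set g : L2 := ((1 : ℝ) : ℂ) • ψ.fn - ψ.dfn with hg
  have hF := integral_smul_expTail one_pos (Ψ := fun x => deriv φ x + φ x) (hφ'c.add hφc)
    (hc.deriv.add hc) g
  have iu := (integrable_test_smul hφc hc ψ.fn).integrableOn (s := Ioi 0)
  have iu' := (integrable_test_smul hφ'c hc.deriv ψ.fn).integrableOn (s := Ioi 0)
  have iv := (integrable_test_smul hφc hc ψ.dfn).integrableOn (s := Ioi 0)
  have ig := (integrable_test_smul hφc hc g).integrableOn (s := Ioi 0)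
  have e1 : ∫ x in Ioi 0, (deriv φ x + φ x) • expTail 1 x g
      = (∫ x in Ioi 0, deriv φ x • ψ.fn x) + ∫ x in Ioi 0, φ x • ψ.fn x := by
    rw [← integral_add iu' iu]
    refine setIntegral_congr_ae measurableSet_Ioi ?_
    filter_upwards [ψ.weakDeriv_right.ae_eq_expTail one_pos] with x hx h
    rw [← hx h, add_smul]
  have e2 : ∫ x in Ioi 0, φ x • g x
      = (∫ x in Ioi 0, φ x • ψ.fn x) - ∫ x in Ioi 0, φ x • ψ.dfn x := by
    rw [← integral_sub iu iv]
    refine integral_congr_ae (ae_restrict_of_ae ?_)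
    filter_upwards [Lp.coeFn_sub (((1 : ℝ) : ℂ) • ψ.fn) ψ.dfn,
      Lp.coeFn_smul ((1 : ℝ) : ℂ) ψ.fn] with s h1 h2
    rw [hg, h1, Pi.sub_apply, h2, Pi.smul_apply, Complex.ofReal_one, one_smul, smul_sub]
  have e3 : ∫ s in Ioi 0, (∫ x in (0 : ℝ)..s, (deriv φ x + φ x) * Real.exp (1 * (x - s))) • g s
      = (∫ x in Ioi 0, φ x • g x) - φ 0 • ψ.rightValue := by
    have hr : ψ.rightValue = ∫ s in Ioi 0, Real.exp (1 * (0 - s)) • g s := by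
      rw [Q.rightValue_eq one_pos, rightEval_apply]
      rfl
    have ie : IntegrableOn (fun s => φ 0 • Real.exp (1 * (0 - s)) • g s) (Ioi 0) :=
      Integrable.smul (φ 0) (integrableOn_exp_smul one_pos 0 0 g)
    rw [hr, ← integral_smul, ← integral_sub ig ie]
    refine integral_congr_ae (ae_of_all _ fun s => ?_)
    have := expPrimitive_deriv_add hφ s
    rw [expPrimitive] at this
    simp only [this, sub_smul, smul_smul]
    simp
  rw [e1, e3, e2] at hF
  linear_combination hF

/-- A function in `Q` with vanishing boundary values belongs to `H¹(ℝ)`. -/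
lemma Q.hasWeakDerivOn_univ {ψ : Q} (hr : ψ.rightValue = 0) (hl : ψ.leftValue = 0) :
    HasWeakDerivOn univ ψ.fn ψ.dfn := by
  intro φ hφ hc _
  have hφc := hφ.continuous
  have hφ'c : Continuous (deriv φ) := hφ.continuous_deriv (by simp)
  have h1 := ψ.integral_Ioi_deriv_smul hφ hc
  have hc' : HasCompactSupport fun x => φ (-x) := hc.comp_homeomorph (Homeomorph.neg ℝ)
  have h2 := (reflect ψ).integral_Ioi_deriv_smul (hφ.comp contDiff_neg) hc'
  have hd : ∀ x, deriv (fun y => φ (-y)) x = - deriv φ (-x) := fun x => deriv_comp_neg _ _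
  rw [Q.rightValue_reflect, hl, smul_zero, sub_zero] at h2
  rw [hr, smul_zero, sub_zero] at h1
  have flip : ∀ (ξ : ℝ → ℝ) (w : L2), ∫ x in Ioi 0, ξ (-x) • reflL2 w x
      = ∫ x in Iio 0, ξ x • w x := by
    intro ξ w
    have : ∫ x in Iic (-0 : ℝ), ξ x • w x = ∫ x in Ioi 0, ξ (-x) • w (-x) :=
      (integral_comp_neg_Ioi 0 (fun x => ξ x • w x)).symm
    rw [neg_zero, integral_Iic_eq_integral_Iio] at this
    rw [this]
    refine integral_congr_ae (ae_restrict_of_ae ?_)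
    filter_upwards [reflL2_coe w] with x hx
    rw [hx]
  have e1 : ∫ x in Ioi 0, deriv (φ ∘ fun y => -y) x • (reflect ψ).fn x
      = - ∫ x in Iio 0, deriv φ x • ψ.fn x := by
    rw [← flip, ← integral_neg]
    refine integral_congr_ae (ae_of_all _ fun x => ?_)
    change deriv (fun y => φ (-y)) x • _ = _
    rw [hd, neg_smul, reflect_fn]
  have e2 : ∫ x in Ioi 0, (φ ∘ fun y => -y) x • (reflect ψ).dfn x
      = - ∫ x in Iio 0, φ x • ψ.dfn x := by
    rw [← flip, ← integral_neg]
    refine integral_congr_ae (ae_restrict_of_ae ?_)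
    filter_upwards [Lp.coeFn_neg (reflL2 ψ.dfn)] with x hx
    rw [reflect_dfn, hx, Pi.neg_apply, smul_neg]
    rfl
  have h2' : ∫ x in Iio 0, deriv φ x • ψ.fn x = - ∫ x in Iio 0, φ x • ψ.dfn x := by
    have := (e1.symm.trans h2).trans (congrArg Neg.neg e2)
    exact neg_injective this
  rw [← integral_Iio_add_Ioi (integrable_test_smul hφ'c hc.deriv ψ.fn),
    ← integral_Iio_add_Ioi (integrable_test_smul hφc hc ψ.dfn), h1, h2']
  ring

/-- `u ↦ u(· + t)` on `L²`. -/
def translL2 (t : ℝ) : L2 →ₗᵢ[ℂ] L2 :=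
  Lp.compMeasurePreservingₗᵢ ℂ (fun x : ℝ => x + t) (measurePreserving_add_right volume t)

lemma translL2_coe (t : ℝ) (u : L2) : translL2 t u =ᵐ[volume] fun x => u (x + t) :=
  Lp.coeFn_compMeasurePreserving u (measurePreserving_add_right volume t)

lemma integral_smul_translL2 (t : ℝ) (φ : ℝ → ℝ) (u : L2) :
    ∫ x, φ x • translL2 t u x = ∫ x, φ (x - t) • u x := by
  rw [← integral_add_right_eq_self (fun x => φ (x - t) • u x) t]
  refine integral_congr_ae ?_
  filter_upwards [translL2_coe t u] with x hx
  rw [hx, add_sub_cancel_right]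

/-- The derivative must be taken on the whole line: a jump at the origin would be carried elsewhere,
and the translate would leave Q. -/
lemma HasWeakDerivOn.transl {u v : L2} (h : HasWeakDerivOn univ u v) (t : ℝ) :
    HasWeakDerivOn univ (translL2 t u) (translL2 t v) := by
  intro φ hφ hc _
  rw [integral_smul_translL2, integral_smul_translL2]
  have := h (fun x => φ (x - t)) (hφ.comp (contDiff_id.sub contDiff_const))
    (hc.comp_homeomorph (Homeomorph.subRight t)) (subset_univ _)
  simpa only [deriv_comp_sub_const] using this

lemma HasWeakDerivOn.mono {Ω Ω' : Set ℝ} {u v : L2} (h : HasWeakDerivOn Ω u v) (hs : Ω' ⊆ Ω) :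
    HasWeakDerivOn Ω' u v := fun φ hφ hc ht => h φ hφ hc (ht.trans hs)

/-- The translate `ψ(· + t)` of a function with vanishing boundary values. -/
def Q.transl (ψ : Q) (hr : ψ.rightValue = 0) (hl : ψ.leftValue = 0) (t : ℝ) : Q :=
  Q.mk' (translL2 t ψ.fn) (translL2 t ψ.dfn)
    (((Q.hasWeakDerivOn_univ hr hl).transl t).mono (subset_univ _))
    (((Q.hasWeakDerivOn_univ hr hl).transl t).mono (subset_univ _))

lemma ae_translL2_fn_eq (ψ : Q) (t : ℝ) : ∀ᵐ x : ℝ, translL2 t ψ.fn x = evalL (x + t) ψ := by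
  have hq := (measurePreserving_add_right (volume : Measure ℝ) t).quasiMeasurePreserving
  filter_upwards [translL2_coe t ψ.fn, hq.ae (ae_eq_evalL ψ)] with x h1 h2
  rw [h1, h2]

lemma tendsto_evalL_add (ψ : Q) {t : ℝ} (ht : t ≠ 0) :
    Tendsto (fun x => evalL (x + t) ψ) (𝓝 0) (𝓝 (evalL t ψ)) := by
  have h1 : Tendsto (fun x : ℝ => x + t) (𝓝 0) (𝓝 t) := by
    have : Continuous fun x : ℝ => x + t := by fun_prop
    simpa using this.tendsto 0
  exact (continuousAt_evalL ψ ht).tendsto.comp h1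

lemma Q.rightValue_transl (ψ : Q) (hr : ψ.rightValue = 0) (hl : ψ.leftValue = 0) {t : ℝ}
    (ht : t ≠ 0) : (ψ.transl hr hl t).rightValue = evalL t ψ :=
  Q.rightValue_eq_of_ae (by filter_upwards [ae_translL2_fn_eq ψ t] with x hx _ using hx)
    ((tendsto_evalL_add ψ ht).mono_left nhdsWithin_le_nhds)

lemma Q.leftValue_transl (ψ : Q) (hr : ψ.rightValue = 0) (hl : ψ.leftValue = 0) {t : ℝ}
    (ht : t ≠ 0) : (ψ.transl hr hl t).leftValue = evalL t ψ :=
  Q.leftValue_eq_of_ae (by filter_upwards [ae_translL2_fn_eq ψ t] with x hx _ using hx)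
    ((tendsto_evalL_add ψ ht).mono_left nhdsWithin_le_nhds)

/-! ### The power functional -/

lemma rpow_two_mul_add_two {t μ : ℝ} (ht : 0 ≤ t) (hμ : 0 < μ) :
    t ^ (2 * μ + 2) = t ^ (2 * μ) * t ^ 2 := by
  rw [Real.rpow_add_of_nonneg ht (by linarith) (by norm_num), Real.rpow_two]

lemma rpow_le_mul_sq {t M μ : ℝ} (ht : 0 ≤ t) (htM : t ≤ M) (hμ : 0 < μ) :
    t ^ (2 * μ + 2) ≤ M ^ (2 * μ) * t ^ 2 := by
  rw [rpow_two_mul_add_two ht hμ]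
  exact mul_le_mul_of_nonneg_right (Real.rpow_le_rpow ht htM (by linarith)) (sq_nonneg t)

/-- Bernoulli's inequality at s/t. The right side is kept quadratic in (s, t) so that it can be
integrated with L² bounds only. -/
lemma rpow_sub_rpow_le {s t M μ : ℝ} (hs : 0 ≤ s) (hst : s ≤ t) (htM : t ≤ M) (hμ : 0 < μ) :
    t ^ (2 * μ + 2) - s ^ (2 * μ + 2) ≤ (2 * μ + 2) * M ^ (2 * μ) * ((s + t) * (t - s)) := by
  rcases (hs.trans hst).eq_or_lt with h0 | ht
  · have : s = 0 := le_antisymm (hst.trans h0.symm.le) hs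
    rw [← h0, this]
    simp
  have hb := one_add_mul_self_le_rpow_one_add (s := s / t - 1) (p := 2 * μ + 2)
    (by have : 0 ≤ s / t := by positivity
        linarith) (by linarith)
  rw [add_sub_cancel, Real.div_rpow hs ht.le] at hb
  have htp : 0 < t ^ (2 * μ + 2) := Real.rpow_pos_of_pos ht _
  have h1 : t ^ (2 * μ + 2) * (1 + (2 * μ + 2) * (s / t - 1)) ≤ s ^ (2 * μ + 2) := by
    rw [le_div_iff₀ htp] at hb
    linarith
  have h2 : t ^ (2 * μ + 2) * (1 + (2 * μ + 2) * (s / t - 1))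
      = t ^ (2 * μ + 2) - (2 * μ + 2) * t ^ (2 * μ) * (t * (t - s)) := by
    rw [rpow_two_mul_add_two ht.le hμ]
    field_simp
    ring
  have h3 : t ^ (2 * μ) ≤ M ^ (2 * μ) := Real.rpow_le_rpow ht.le htM (by linarith)
  have h4 : (2 * μ + 2) * t ^ (2 * μ) * (t * (t - s))
      ≤ (2 * μ + 2) * M ^ (2 * μ) * ((s + t) * (t - s)) := by
    refine mul_le_mul (mul_le_mul_of_nonneg_left h3 (by linarith))
      (mul_le_mul_of_nonneg_right (by linarith) (by linarith))
      (mul_nonneg ht.le (by linarith)) ?_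
    have : 0 ≤ M ^ (2 * μ) := Real.rpow_nonneg (ht.le.trans htM) _
    positivity
  linarith

lemma abs_rpow_sub_rpow_le {s t M μ : ℝ} (hs : 0 ≤ s) (ht : 0 ≤ t) (hsM : s ≤ M) (htM : t ≤ M)
    (hμ : 0 < μ) :
    |s ^ (2 * μ + 2) - t ^ (2 * μ + 2)| ≤ (2 * μ + 2) * M ^ (2 * μ) * ((s + t) * |s - t|) := by
  rcases le_total s t with h | h
  · rw [abs_sub_comm, abs_sub_comm s t, abs_of_nonneg (sub_nonneg.2 h), abs_of_nonneg]
    · exact rpow_sub_rpow_le hs h htM hμ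
    · exact sub_nonneg.2 (Real.rpow_le_rpow hs h (by linarith))
  · rw [abs_of_nonneg (sub_nonneg.2 h), abs_of_nonneg, add_comm s t]
    · exact rpow_sub_rpow_le ht h hsM hμ
    · exact sub_nonneg.2 (Real.rpow_le_rpow ht h (by linarith))

lemma aestronglyMeasurable_rpow (μ : ℝ) (u : L2) (hμ : 0 < μ) :
    AEStronglyMeasurable (fun x => ‖u x‖ ^ (2 * μ + 2)) volume := by
  have hc : Continuous fun t : ℝ => t ^ (2 * μ + 2) :=
    Real.continuous_rpow_const (by linarith)
  exact hc.comp_aestronglyMeasurable (Lp.aestronglyMeasurable u).norm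

lemma integrable_rpow_of_bound {μ δ : ℝ} (hμ : 0 < μ) {u : L2} (h : ∀ᵐ x : ℝ, ‖u x‖ ≤ δ) :
    Integrable (fun x => ‖u x‖ ^ (2 * μ + 2)) := by
  refine ((L2_integrable_sq u).const_mul (δ ^ (2 * μ))).mono' (aestronglyMeasurable_rpow μ u hμ) ?_
  filter_upwards [h] with x hx
  rw [Real.norm_of_nonneg (Real.rpow_nonneg (norm_nonneg _) _)]
  exact rpow_le_mul_sq (norm_nonneg _) hx hμ

lemma integrable_rpow_fn {μ : ℝ} (hμ : 0 < μ) (ψ : Q) :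
    Integrable (fun x => ‖ψ.fn x‖ ^ (2 * μ + 2)) :=
  integrable_rpow_of_bound hμ (ae_norm_fn_le ψ)

lemma powerNorm_nonneg (μ : ℝ) (ψ : Q) : 0 ≤ powerNorm μ ψ :=
  integral_nonneg fun _ => Real.rpow_nonneg (norm_nonneg _) _

lemma powerNorm_le_of_bound {μ δ : ℝ} (hμ : 0 < μ) {ψ : Q} (h : ∀ᵐ x : ℝ, ‖ψ.fn x‖ ≤ δ) :
    powerNorm μ ψ ≤ δ ^ (2 * μ) * ‖ψ.fn‖ ^ 2 := by
  rw [L2_norm_sq, ← integral_const_mul]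
  refine integral_mono_ae (integrable_rpow_of_bound hμ h) ((L2_integrable_sq _).const_mul _) ?_
  filter_upwards [h] with x hx
  exact rpow_le_mul_sq (norm_nonneg _) hx hμ

lemma Q.norm_fn_le (ψ : Q) : ‖ψ.fn‖ ≤ ‖ψ‖ := by
  refine le_of_sq_le_sq ?_ (norm_nonneg _)
  rw [Q.norm_sq]
  linarith [sq_nonneg ‖ψ.dfn‖]

lemma powerNorm_le {μ : ℝ} (hμ : 0 < μ) (ψ : Q) :
    powerNorm μ ψ ≤ ‖ψ‖ ^ (2 * μ) * ‖ψ‖ ^ 2 :=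
  (powerNorm_le_of_bound hμ (ae_norm_fn_le ψ)).trans
    (mul_le_mul_of_nonneg_left (pow_le_pow_left₀ (norm_nonneg _) ψ.norm_fn_le 2)
      (Real.rpow_nonneg (norm_nonneg _) _))

lemma powerNorm_smul (μ : ℝ) (c : ℂ) (ψ : Q) :
    powerNorm μ (c • ψ) = ‖c‖ ^ (2 * μ + 2) * powerNorm μ ψ := by
  rw [powerNorm, powerNorm, ← integral_const_mul]
  refine integral_congr_ae ?_
  filter_upwards [Lp.coeFn_smul c ψ.fn] with x hx
  rw [Q.fn_smul, hx, Pi.smul_apply, norm_smul, Real.mul_rpow (norm_nonneg _) (norm_nonneg _)]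

lemma integral_norm_mul_norm_le (u v : L2) : ∫ x, ‖u x‖ * ‖v x‖ ≤ ‖u‖ * ‖v‖ := by
  have hu : MemLp (fun x => ‖u x‖) (ENNReal.ofReal 2) volume := by
    simpa using (Lp.memLp u).norm
  have hv : MemLp (fun x => ‖v x‖) (ENNReal.ofReal 2) volume := by
    simpa using (Lp.memLp v).norm
  have h := integral_mul_le_Lp_mul_Lq_of_nonneg (μ := volume) Real.HolderConjugate.two_two
    (ae_of_all _ fun x => norm_nonneg (u x)) (ae_of_all _ fun x => norm_nonneg (v x)) hu hv
  simp only [Real.rpow_two] at h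
  rw [← L2_norm_sq, ← L2_norm_sq, ← Real.sqrt_eq_rpow, ← Real.sqrt_eq_rpow,
    Real.sqrt_sq (norm_nonneg _), Real.sqrt_sq (norm_nonneg _)] at h
  exact h

lemma integrable_norm_mul_norm (u v : L2) : Integrable fun x => ‖u x‖ * ‖v x‖ :=
  (Lp.memLp u).norm.integrable_mul (Lp.memLp v).norm

lemma abs_powerNorm_sub_le {μ M : ℝ} (hμ : 0 < μ) {φ ψ : Q} (hφ : ‖φ‖ ≤ M) (hψ : ‖ψ‖ ≤ M) :
    |powerNorm μ φ - powerNorm μ ψ|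
      ≤ (2 * μ + 2) * M ^ (2 * μ) * (2 * M) * ‖φ - ψ‖ := by
  have hM : 0 ≤ M := (norm_nonneg _).trans hφ
  obtain ⟨K, hK⟩ : ∃ K, K = (2 * μ + 2) * M ^ (2 * μ) := ⟨_, rfl⟩
  rw [← hK]
  have hK0 : 0 ≤ K := by
    rw [hK]
    exact mul_nonneg (by linarith) (Real.rpow_nonneg hM _)
  have i1 := integrable_norm_mul_norm φ.fn (φ - ψ).fn
  have i2 := integrable_norm_mul_norm ψ.fn (φ - ψ).fn
  rw [powerNorm, powerNorm, ← integral_sub (integrable_rpow_fn hμ φ) (integrable_rpow_fn hμ ψ)]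
  have h1 : |∫ x, (‖φ.fn x‖ ^ (2 * μ + 2) - ‖ψ.fn x‖ ^ (2 * μ + 2))|
      ≤ ∫ x, K * (‖φ.fn x‖ * ‖(φ - ψ).fn x‖ + ‖ψ.fn x‖ * ‖(φ - ψ).fn x‖) := by
    have i3 : Integrable fun x =>
        K * (‖φ.fn x‖ * ‖(φ - ψ).fn x‖ + ‖ψ.fn x‖ * ‖(φ - ψ).fn x‖) := (i1.add i2).const_mul K
    rw [← Real.norm_eq_abs]
    refine norm_integral_le_of_norm_le i3 ?_
    filter_upwards [ae_norm_fn_le φ, ae_norm_fn_le ψ, Lp.coeFn_sub φ.fn ψ.fn] with x h1 h2 h3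
    rw [Real.norm_eq_abs]
    refine (abs_rpow_sub_rpow_le (norm_nonneg _) (norm_nonneg _) (h1.trans hφ) (h2.trans hψ)
      hμ).trans ?_
    rw [← hK]
    refine mul_le_mul_of_nonneg_left ?_ hK0
    rw [← add_mul]
    refine mul_le_mul_of_nonneg_left ?_ (by positivity)
    rw [Q.fn_sub, h3, Pi.sub_apply]
    exact abs_norm_sub_norm_le _ _
  refine h1.trans ?_
  rw [integral_const_mul, integral_add i1 i2, mul_assoc]
  refine mul_le_mul_of_nonneg_left ?_ hK0
  have e1 := integral_norm_mul_norm_le φ.fn (φ - ψ).fn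
  have e2 := integral_norm_mul_norm_le ψ.fn (φ - ψ).fn
  have e3 := (φ - ψ).norm_fn_le
  have e4 : ‖φ.fn‖ * ‖(φ - ψ).fn‖ ≤ M * ‖φ - ψ‖ :=
    mul_le_mul (φ.norm_fn_le.trans hφ) e3 (norm_nonneg _) hM
  have e5 : ‖ψ.fn‖ * ‖(φ - ψ).fn‖ ≤ M * ‖φ - ψ‖ :=
    mul_le_mul (ψ.norm_fn_le.trans hψ) e3 (norm_nonneg _) hM
  linarith

/-! ### Splitting of the functionals along weakly convergent sequences -/

/-- Point evaluations are bounded functionals on Q, so no local compactness argument is needed. -/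
lemma WeaklyTendsto.ae_tendsto {u : ℕ → Q} {ψ : Q} (h : WeaklyTendsto u ψ) :
    ∀ᵐ x : ℝ, Tendsto (fun n => (u n).fn x) atTop (𝓝 (ψ.fn x)) := by
  have h1 : ∀ᵐ x : ℝ, ∀ n, (u n).fn x = evalL x (u n) := ae_all_iff.2 fun n => ae_eq_evalL (u n)
  filter_upwards [h1, ae_eq_evalL ψ] with x hx hx'
  simp_rw [hx, hx']
  exact h (evalL x)

/-- Used with s = |u_n|, t = |u_n - ψ|, b = |ψ|. Young's inequality puts the small factor on t²,
which is only bounded in mean, and the large one on b², which is a fixed integrable function. -/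
lemma brezisLieb_pointwise {s t b K M μ ε : ℝ} (hs : 0 ≤ s) (ht : 0 ≤ t) (hb : 0 ≤ b)
    (hsM : s ≤ M) (htM : t ≤ M) (hbM : b ≤ M) (hst : |s - t| ≤ b) (hμ : 0 < μ) (hε : 0 < ε)
    (hK : K = (2 * μ + 2) * M ^ (2 * μ)) :
    |s ^ (2 * μ + 2) - t ^ (2 * μ + 2) - b ^ (2 * μ + 2)|
      ≤ K * ε * t ^ 2 + (K * (1 + 1 / ε) + M ^ (2 * μ)) * b ^ 2 := by
  have hM : 0 ≤ M ^ (2 * μ) := Real.rpow_nonneg (hs.trans hsM) _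
  have hK0 : 0 ≤ K := by rw [hK]; positivity
  have h1 := abs_rpow_sub_rpow_le hs ht hsM htM hμ
  rw [← hK] at h1
  have h2 := rpow_le_mul_sq hb hbM hμ
  have h3 : (s + t) * |s - t| ≤ (2 * t + b) * b := by
    have : s ≤ t + b := by linarith [(abs_le.1 hst).2]
    exact mul_le_mul (by linarith) hst (abs_nonneg _) (by positivity)
  have h4 : (2 * t + b) * b ≤ ε * t ^ 2 + (1 + 1 / ε) * b ^ 2 := by
    have e : ε * t ^ 2 + (1 + 1 / ε) * b ^ 2 - (2 * t + b) * b = (ε * t - b) ^ 2 / ε := by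
      field_simp
      ring
    have : 0 ≤ (ε * t - b) ^ 2 / ε := by positivity
    linarith
  have h5 := mul_le_mul_of_nonneg_left (h3.trans h4) hK0
  have h6 : |s ^ (2 * μ + 2) - t ^ (2 * μ + 2) - b ^ (2 * μ + 2)|
      ≤ |s ^ (2 * μ + 2) - t ^ (2 * μ + 2)| + b ^ (2 * μ + 2) := by
    refine (abs_sub _ _).trans_eq ?_
    rw [abs_of_nonneg (Real.rpow_nonneg hb _)]
  linarith

/-- The Brezis–Lieb splitting of the power functional. -/
lemma tendsto_powerNorm_split {μ M : ℝ} (hμ : 0 < μ) {u : ℕ → Q} {ψ : Q}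
    (hb : ∀ n, ‖u n‖ ≤ M) (h : WeaklyTendsto u ψ) :
    Tendsto (fun n => powerNorm μ (u n) - powerNorm μ (u n - ψ) - powerNorm μ ψ) atTop (𝓝 0) := by
  have hM0 : 0 ≤ M := (norm_nonneg _).trans (hb 0)
  set R := M + ‖ψ‖ with hR
  have hR0 : 0 ≤ R := by positivity
  have hub : ∀ n, ‖u n‖ ≤ R := fun n => (hb n).trans (by linarith [norm_nonneg ψ])
  have hab : ∀ n, ‖u n - ψ‖ ≤ R := fun n => (norm_sub_le _ _).trans (by linarith [hb n])
  have hψb : ‖ψ‖ ≤ R := by linarith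
  obtain ⟨K, hK⟩ : ∃ K, K = (2 * μ + 2) * R ^ (2 * μ) := ⟨_, rfl⟩
  have hRμ : 0 ≤ R ^ (2 * μ) := Real.rpow_nonneg hR0 _
  have hK0 : 0 ≤ K := by rw [hK]; positivity
  let D : ℕ → ℝ → ℝ := fun n x => ‖(u n).fn x‖ ^ (2 * μ + 2) - ‖(u n - ψ).fn x‖ ^ (2 * μ + 2)
    - ‖ψ.fn x‖ ^ (2 * μ + 2)
  have hDint : ∀ n, Integrable (D n) := fun n =>
    ((integrable_rpow_fn hμ (u n)).sub (integrable_rpow_fn hμ (u n - ψ))).sub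
      (integrable_rpow_fn hμ ψ)
  have hDeq : ∀ n, powerNorm μ (u n) - powerNorm μ (u n - ψ) - powerNorm μ ψ = ∫ x, D n x := by
    intro n
    have i1 : Integrable fun x => ‖(u n).fn x‖ ^ (2 * μ + 2) - ‖(u n - ψ).fn x‖ ^ (2 * μ + 2) :=
      (integrable_rpow_fn hμ (u n)).sub (integrable_rpow_fn hμ (u n - ψ))
    rw [powerNorm, powerNorm, powerNorm, integral_sub i1 (integrable_rpow_fn hμ ψ),
      integral_sub (integrable_rpow_fn hμ (u n)) (integrable_rpow_fn hμ (u n - ψ))]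
  simp_rw [hDeq]
  have hsub : ∀ᵐ x : ℝ, ∀ n, (u n - ψ).fn x = (u n).fn x - ψ.fn x :=
    ae_all_iff.2 fun n => Lp.coeFn_sub (u n).fn ψ.fn
  have hpt := h.ae_tendsto
  have hDlim : ∀ᵐ x : ℝ, Tendsto (fun n => D n x) atTop (𝓝 0) := by
    filter_upwards [hsub, hpt] with x hx hl
    have hc : Continuous fun t : ℂ => ‖t‖ ^ (2 * μ + 2) :=
      (Real.continuous_rpow_const (by linarith)).comp continuous_norm
    have l1 := (hc.tendsto _).comp hl
    have l2 := (hc.tendsto _).comp (hl.sub_const (ψ.fn x))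
    have l3 := (l1.sub l2).sub_const (‖ψ.fn x‖ ^ (2 * μ + 2))
    have e0 : ‖ψ.fn x‖ ^ (2 * μ + 2) - ‖ψ.fn x - ψ.fn x‖ ^ (2 * μ + 2)
        - ‖ψ.fn x‖ ^ (2 * μ + 2) = 0 := by
      rw [sub_self (ψ.fn x), norm_zero, Real.zero_rpow (by linarith)]
      ring
    rw [e0] at l3
    refine l3.congr fun n => ?_
    simp only [D, hx, Function.comp_apply]
  rw [Metric.tendsto_atTop]
  intro η hη
  obtain ⟨ε, hε, hεη⟩ : ∃ ε > 0, K * ε * R ^ 2 < η / 2 := by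
    refine ⟨η / (4 * (K * R ^ 2 + 1)), by positivity, ?_⟩
    have : K * (η / (4 * (K * R ^ 2 + 1))) * R ^ 2 = η / 4 * (K * R ^ 2 / (K * R ^ 2 + 1)) := by
      field_simp
    rw [this]
    have h1 : K * R ^ 2 / (K * R ^ 2 + 1) ≤ 1 := (div_le_one (by positivity)).2 (by linarith)
    nlinarith
  set C := K * (1 + 1 / ε) + R ^ (2 * μ) with hC
  have hC0 : 0 ≤ C := by positivity
  -- The excess over the ε-term is dominated by C|ψ|² and tends to zero pointwise, while the ε-term
  -- itself integrates to less than η/2.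
  let f : ℕ → ℝ → ℝ := fun n x => max (|D n x| - K * ε * ‖(u n - ψ).fn x‖ ^ 2) 0
  have hle : ∀ n, ∀ᵐ x : ℝ, |D n x| ≤ K * ε * ‖(u n - ψ).fn x‖ ^ 2 + C * ‖ψ.fn x‖ ^ 2 := by
    intro n
    filter_upwards [hsub, ae_norm_fn_le (u n), ae_norm_fn_le (u n - ψ), ae_norm_fn_le ψ]
      with x h1 h2 h3 h4
    refine brezisLieb_pointwise (norm_nonneg _) (norm_nonneg _) (norm_nonneg _)
      (h2.trans (hub n)) (h3.trans (hab n)) (h4.trans hψb) ?_ hμ hε hK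
    have := abs_norm_sub_norm_le ((u n).fn x) ((u n - ψ).fn x)
    rwa [show (u n).fn x - (u n - ψ).fn x = ψ.fn x by rw [h1]; ring] at this
  have hfint : ∀ n, Integrable (f n) := fun n =>
    ((hDint n).abs.sub ((L2_integrable_sq _).const_mul _)).pos_part
  have hflim : Tendsto (fun n => ∫ x, f n x) atTop (𝓝 (∫ _ : ℝ, (0 : ℝ))) := by
    refine tendsto_integral_of_dominated_convergence (fun x => C * ‖ψ.fn x‖ ^ 2)
      (fun n => (hfint n).aestronglyMeasurable) ((L2_integrable_sq _).const_mul _) (fun n => ?_) ?_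
    · filter_upwards [hle n] with x hx
      rw [Real.norm_of_nonneg (le_max_right _ _)]
      exact max_le (by linarith) (by positivity)
    · filter_upwards [hDlim] with x hx
      have hx' : Tendsto (fun n => |D n x|) atTop (𝓝 0) := by simpa using hx.abs
      refine squeeze_zero (fun n => le_max_right _ _) (fun n => ?_) hx'
      exact max_le (by linarith [show 0 ≤ K * ε * ‖(u n - ψ).fn x‖ ^ 2 by positivity])
        (abs_nonneg _)
  rw [integral_zero, Metric.tendsto_atTop] at hflim
  obtain ⟨n₀, hn₀⟩ := hflim (η / 2) (by positivity)
  refine ⟨n₀, fun n hn => ?_⟩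
  have h1 := hn₀ n hn
  rw [Real.dist_eq, sub_zero] at h1 ⊢
  have h2 : |∫ x, D n x| ≤ ∫ x, (f n x + K * ε * ‖(u n - ψ).fn x‖ ^ 2) := by
    have i1 : Integrable fun x => f n x + K * ε * ‖(u n - ψ).fn x‖ ^ 2 :=
      (hfint n).add ((L2_integrable_sq _).const_mul _)
    rw [← Real.norm_eq_abs]
    refine norm_integral_le_of_norm_le i1 ?_
    filter_upwards with x
    have : |D n x| - K * ε * ‖(u n - ψ).fn x‖ ^ 2 ≤ f n x := le_max_left _ _
    rw [Real.norm_eq_abs]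
    linarith
  rw [integral_add (hfint n) ((L2_integrable_sq _).const_mul _), integral_const_mul,
    ← L2_norm_sq] at h2
  have h3 : ‖(u n - ψ).fn‖ ^ 2 ≤ R ^ 2 :=
    pow_le_pow_left₀ (norm_nonneg _) ((u n - ψ).norm_fn_le.trans (hab n)) 2
  have h4 : K * ε * ‖(u n - ψ).fn‖ ^ 2 ≤ K * ε * R ^ 2 :=
    mul_le_mul_of_nonneg_left h3 (by positivity)
  have h5 := le_abs_self (∫ x, f n x)
  linarith

/-- The cross term 2 Re⟨Tψ, T(u_n - ψ)⟩ is controlled by a bounded functional of u_n - ψ. Taking T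
to be the derivative, the jump and the inclusion in L² covers all of `nehariQuad`. -/
lemma tendsto_norm_sq_split {H : Type*} [NormedAddCommGroup H] [InnerProductSpace ℂ H]
    (T : Q →L[ℂ] H) {u : ℕ → Q} {ψ : Q} (h : WeaklyTendsto u ψ) :
    Tendsto (fun n => ‖T (u n)‖ ^ 2 - ‖T (u n - ψ)‖ ^ 2 - ‖T ψ‖ ^ 2) atTop (𝓝 0) := by
  have h1 := h (innerSL ℂ (T ψ) ∘L T)
  have h2 : Tendsto (fun n => 2 * ((innerSL ℂ (T ψ) ∘L T) (u n)
      - (innerSL ℂ (T ψ) ∘L T) ψ).re) atTop (𝓝 0) := by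
    have h3 := h1.sub_const ((innerSL ℂ (T ψ) ∘L T) ψ)
    rw [sub_self] at h3
    simpa using ((Complex.continuous_re.tendsto 0).comp h3).const_mul 2
  refine h2.congr fun n => ?_
  have e : T (u n) = T ψ + T (u n - ψ) := by rw [← map_add, add_sub_cancel]
  rw [← map_sub]
  have := norm_add_sq (𝕜 := ℂ) (T ψ) (T (u n - ψ))
  rw [e, this]
  change 2 * (inner ℂ (T ψ) (T (u n - ψ))).re = _
  simp only [RCLike.re_eq_complex_re]
  ring

/-! ### Weak sequential compactness -/

lemma continuous_integral_smul {φ : ℝ → ℝ} (hφ : Continuous φ) (hc : HasCompactSupport φ) :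
    Continuous fun u : L2 => ∫ x, φ x • u x := by
  have hφ2 : MemLp (fun x => (φ x : ℂ)) 2 volume :=
    (Complex.continuous_ofReal.comp hφ).memLp_of_hasCompactSupport (hc.comp_left Complex.ofReal_zero)
  have e : (fun u : L2 => ∫ x, φ x • u x) = fun u => inner ℂ (hφ2.toLp _) u := by
    funext u
    rw [L2.inner_def]
    refine integral_congr_ae ?_
    filter_upwards [hφ2.coeFn_toLp] with x hx
    rw [hx]
    simp [RCLike.inner_apply, mul_comm]
  rw [e]
  fun_prop

/-- Each test function imposes an equality of two continuous functionals. Closedness makes Q a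
Hilbert space, as weak compactness requires. -/
lemma isClosed_energySpace : IsClosed (energySpace : Set (WithLp 2 (L2 × L2))) := by
  have key : ∀ Ω : Set ℝ, IsClosed {p : WithLp 2 (L2 × L2) | HasWeakDerivOn Ω p.fst p.snd} := by
    intro Ω
    simp only [HasWeakDerivOn, ofPred_forall]
    refine isClosed_iInter fun φ => isClosed_iInter fun hφ => isClosed_iInter fun hc =>
      isClosed_iInter fun _ => isClosed_eq ?_ ?_
    · exact (continuous_integral_smul (hφ.continuous_deriv (by simp)) hc.deriv).comp
        (WithLp.fstL 2 ℂ L2 L2).continuous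
    · exact ((continuous_integral_smul hφ.continuous hc).comp
        (WithLp.sndL 2 ℂ L2 L2).continuous).neg
  exact (key (Ioi 0)).inter (key (Iio 0))

instance completeSpace_Q : CompleteSpace Q :=
  isClosed_energySpace.completeSpace_coe

instance separableSpace_Q : TopologicalSpace.SeparableSpace Q := by
  have h0 : Fact ((2 : ENNReal) ≠ ⊤) := ⟨by norm_num⟩
  have h1 : SecondCountableTopology L2 := inferInstance
  have h2 : SecondCountableTopology (WithLp 2 (L2 × L2)) :=
    WithLp.secondCountableTopology 2 L2 L2
  infer_instance

/-- Bounded sequences in a separable Hilbert space have weakly convergent subsequences. -/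
lemma exists_subseq_tendsto_apply {E : Type*} [NormedAddCommGroup E] [InnerProductSpace ℂ E]
    [CompleteSpace E] [TopologicalSpace.SeparableSpace E] {u : ℕ → E} {M : ℝ}
    (hb : ∀ n, ‖u n‖ ≤ M) :
    ∃ (ψ : E) (k : ℕ → ℕ), StrictMono k ∧
      ∀ ℓ : E →L[ℂ] ℂ, Tendsto (fun n => ℓ (u (k n))) atTop (𝓝 (ℓ ψ)) := by
  let x : ℕ → WeakDual ℂ E := fun n =>
    StrongDual.toWeakDual (InnerProductSpace.toDual ℂ E (u n))
  obtain ⟨y, -, k, hk, hy⟩ := WeakDual.isSeqCompact_closedBall ℂ E 0 M (x := x) (fun n => by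
    change InnerProductSpace.toDual ℂ E (u n) ∈ Metric.closedBall 0 M
    rw [mem_closedBall_zero_iff, LinearIsometryEquiv.norm_map]
    exact hb n)
  refine ⟨(InnerProductSpace.toDual ℂ E).symm (WeakDual.toStrongDual y), k, hk, fun ℓ => ?_⟩
  set ξ := (InnerProductSpace.toDual ℂ E).symm ℓ with hξ
  have hℓ : ∀ v, ℓ v = inner ℂ ξ v := fun v => by
    rw [hξ, InnerProductSpace.toDual_symm_apply]
  have h1 : Tendsto (fun n => (x (k n)) ξ) atTop (𝓝 (y ξ)) :=
    ((WeakDual.eval_continuous ξ).tendsto y).comp hy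
  -- The Riesz map is conjugate-linear, so the weak-* limit of the dual sequence returns through a
  -- conjugation.
  have h2 := (Complex.continuous_conj.tendsto _).comp h1
  simp_rw [hℓ]
  have e1 : ∀ n, inner ℂ ξ (u (k n)) = (starRingEnd ℂ) ((x (k n)) ξ) := fun n =>
    (inner_conj_symm ξ (u (k n))).symm
  have e2 : inner ℂ ξ ((InnerProductSpace.toDual ℂ E).symm (WeakDual.toStrongDual y))
      = (starRingEnd ℂ) (y ξ) := by
    rw [← inner_conj_symm, InnerProductSpace.toDual_symm_apply]
    rfl
  simp_rw [e1, e2]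
  exact h2

/-- Bounded sequences in `Q` have weakly convergent subsequences. -/
lemma exists_weaklyTendsto_subseq {u : ℕ → Q} {M : ℝ} (hb : ∀ n, ‖u n‖ ≤ M) :
    ∃ (ψ : Q) (k : ℕ → ℕ), StrictMono k ∧ WeaklyTendsto (u ∘ k) ψ :=
  exists_subseq_tendsto_apply hb

/-! ### The quadratic part of the Nehari functional -/

/-- The quadratic part `F_γ(ψ) + ω M(ψ)` of the Nehari functional. -/
def nehariQuad (γ ω : ℝ) (ψ : Q) : ℝ := quadForm γ ψ + ω * mass ψ

lemma nehari_eq (γ lam μ ω : ℝ) (ψ : Q) :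
    nehari γ lam μ ω ψ = nehariQuad γ ω ψ - lam * powerNorm μ ψ := rfl

/-- Eliminates the quadratic part, leaving the coefficient λ/2 - λ/(2μ + 2) on P. -/
lemma action_eq {lam μ : ℝ} (hμ : 0 < μ) (γ ω : ℝ) (ψ : Q) :
    action γ lam μ ω ψ = 1 / 2 * nehari γ lam μ ω ψ + reducedAction lam μ ψ := by
  rw [action, energy, nehari, reducedAction]
  have : lam * μ / (2 * (μ + 1)) = lam / 2 - lam / (2 * μ + 2) := by
    field_simp
    ring
  rw [this]
  ring

/-- The jump `ψ(0+) - ψ(0-)` as a bounded functional. -/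
def jumpL : Q →L[ℂ] ℂ := rightValueL - leftValueL

lemma jumpL_apply (ψ : Q) : jumpL ψ = ψ.rightValue - ψ.leftValue := by
  rw [← rightValueL_apply, ← leftValueL_apply]
  rfl

lemma nehariQuad_eq (γ ω : ℝ) (ψ : Q) :
    nehariQuad γ ω ψ = ‖dfnL ψ‖ ^ 2 - γ⁻¹ * ‖jumpL ψ‖ ^ 2 + ω * ‖fnL ψ‖ ^ 2 := by
  rw [jumpL_apply]
  rfl

lemma nehariQuad_smul (γ ω : ℝ) (c : ℂ) (ψ : Q) :
    nehariQuad γ ω (c • ψ) = ‖c‖ ^ 2 * nehariQuad γ ω ψ := by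
  simp only [nehariQuad_eq, map_smul, norm_smul, mul_pow]
  ring

/-- By the jump bound, the coefficients left on ‖ψ'‖² and ‖ψ‖² are 1 - 2/(γa) and ω - 2a/γ. Both are
positive when 2/γ < a < γω/2, and such an a exists exactly when ω > 4/γ². -/
lemma exists_coercive {γ ω : ℝ} (hγ : 0 < γ) (hω : 4 / γ ^ 2 < ω) :
    ∃ c > 0, ∀ ψ : Q, c * ‖ψ‖ ^ 2 ≤ nehariQuad γ ω ψ := by
  have h1 : 2 / γ < γ * ω / 2 := by
    rw [div_lt_iff₀ (by positivity)] at hω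
    rw [div_lt_iff₀ hγ]
    nlinarith
  obtain ⟨a, ha1, ha2⟩ := exists_between h1
  have ha : 0 < a := lt_trans (by positivity) ha1
  have hc1 : 0 < 1 - 2 * γ⁻¹ * a⁻¹ := by
    have : 2 * γ⁻¹ * a⁻¹ < 1 := by
      rw [← div_eq_mul_inv, ← div_eq_mul_inv]
      exact (div_lt_one ha).2 ha1
    linarith
  have hc2 : 0 < ω - 2 * γ⁻¹ * a := by
    have : 2 * γ⁻¹ * a < 2 * γ⁻¹ * (γ * ω / 2) := mul_lt_mul_of_pos_left ha2 (by positivity)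
    have e : 2 * γ⁻¹ * (γ * ω / 2) = ω := by field_simp
    linarith
  refine ⟨min (1 - 2 * γ⁻¹ * a⁻¹) (ω - 2 * γ⁻¹ * a), lt_min hc1 hc2, fun ψ => ?_⟩
  have hj := mul_le_mul_of_nonneg_left (norm_jump_sq_le ha ψ) (inv_pos.2 hγ).le
  have e1 := mul_le_mul_of_nonneg_right (min_le_left (1 - 2 * γ⁻¹ * a⁻¹) (ω - 2 * γ⁻¹ * a))
    (sq_nonneg ‖ψ.dfn‖)
  have e2 := mul_le_mul_of_nonneg_right (min_le_right (1 - 2 * γ⁻¹ * a⁻¹) (ω - 2 * γ⁻¹ * a))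
    (sq_nonneg ‖ψ.fn‖)
  rw [Q.norm_sq, nehariQuad, quadForm, mass, mul_add]
  linarith

lemma tendsto_nehariQuad_split (γ ω : ℝ) {u : ℕ → Q} {ψ : Q} (h : WeaklyTendsto u ψ) :
    Tendsto (fun n => nehariQuad γ ω (u n) - nehariQuad γ ω (u n - ψ) - nehariQuad γ ω ψ)
      atTop (𝓝 0) := by
  have h1 := tendsto_norm_sq_split dfnL h
  have h2 := (tendsto_norm_sq_split jumpL h).const_mul γ⁻¹
  have h3 := (tendsto_norm_sq_split fnL h).const_mul ω
  have h4 := (h1.sub h2).add h3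
  simp only [mul_zero, sub_zero, add_zero] at h4
  refine h4.congr fun n => ?_
  simp only [nehariQuad_eq]
  ring

lemma tendsto_norm_sq_sub {H : Type*} [NormedAddCommGroup H] [NormedSpace ℂ H]
    (T : Q →L[ℂ] H) {u w : ℕ → Q} {M : ℝ} (hu : ∀ n, ‖u n‖ ≤ M) (hw : ∀ n, ‖w n‖ ≤ M)
    (h : Tendsto (fun n => ‖w n - u n‖) atTop (𝓝 0)) :
    Tendsto (fun n => ‖T (w n)‖ ^ 2 - ‖T (u n)‖ ^ 2) atTop (𝓝 0) := by
  have hM : 0 ≤ M := (norm_nonneg _).trans (hu 0)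
  refine squeeze_zero_norm (fun n => ?_)
    (by simpa using h.const_mul (2 * (‖T‖ * M) * ‖T‖))
  rw [sq_sub_sq, norm_mul, mul_assoc]
  have h1 : ‖T (w n)‖ ≤ ‖T‖ * M :=
    (T.le_opNorm _).trans (mul_le_mul_of_nonneg_left (hw n) T.opNorm_nonneg)
  have h2 : ‖T (u n)‖ ≤ ‖T‖ * M :=
    (T.le_opNorm _).trans (mul_le_mul_of_nonneg_left (hu n) T.opNorm_nonneg)
  refine mul_le_mul ?_ ?_ (norm_nonneg _) (by positivity)
  · rw [Real.norm_of_nonneg (by positivity)]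
    linarith
  · rw [Real.norm_eq_abs]
    refine (abs_norm_sub_norm_le _ _).trans ?_
    rw [← map_sub]
    exact T.le_opNorm _

lemma tendsto_nehari_sub {γ lam μ ω M : ℝ} (hμ : 0 < μ) {u w : ℕ → Q} (hu : ∀ n, ‖u n‖ ≤ M)
    (hw : ∀ n, ‖w n‖ ≤ M) (h : Tendsto (fun n => ‖w n - u n‖) atTop (𝓝 0)) :
    Tendsto (fun n => powerNorm μ (w n) - powerNorm μ (u n)) atTop (𝓝 0) ∧
    Tendsto (fun n => nehari γ lam μ ω (w n) - nehari γ lam μ ω (u n)) atTop (𝓝 0) := by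
  have hP : Tendsto (fun n => powerNorm μ (w n) - powerNorm μ (u n)) atTop (𝓝 0) :=
    squeeze_zero_norm (fun n => abs_powerNorm_sub_le hμ (hw n) (hu n))
      (by simpa using h.const_mul ((2 * μ + 2) * M ^ (2 * μ) * (2 * M)))
  refine ⟨hP, ?_⟩
  have h1 := tendsto_norm_sq_sub dfnL hu hw h
  have h2 := (tendsto_norm_sq_sub jumpL hu hw h).const_mul γ⁻¹
  have h3 := (tendsto_norm_sq_sub fnL hu hw h).const_mul ω
  have h4 := ((h1.sub h2).add h3).sub (hP.const_mul lam)
  simp only [mul_zero, sub_zero, add_zero] at h4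
  refine h4.congr fun n => ?_
  simp only [nehari_eq, nehariQuad_eq]
  ring

/-- An element of Q also stores its derivative, which must be shown to vanish: a weak derivative of
zero is zero on each half-line. -/
lemma eq_zero_of_powerNorm_eq_zero {μ : ℝ} (hμ : 0 < μ) {ψ : Q} (h : powerNorm μ ψ = 0) :
    ψ = 0 := by
  have hfn : ψ.fn = 0 := by
    have h1 := (integral_eq_zero_iff_of_nonneg
      (fun x => Real.rpow_nonneg (norm_nonneg (ψ.fn x)) _) (integrable_rpow_fn hμ ψ)).1 h
    apply Lp.ext
    filter_upwards [h1, Lp.coeFn_zero ℂ 2 (volume : Measure ℝ)] with x hx hz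
    rw [hz]
    have := (Real.rpow_eq_zero (norm_nonneg (ψ.fn x)) (by linarith : 2 * μ + 2 ≠ 0)).1 hx
    simpa using this
  have key : ∀ Ω : Set ℝ, IsOpen Ω → HasWeakDerivOn Ω ψ.fn ψ.dfn →
      ∀ᵐ x : ℝ, x ∈ Ω → ψ.dfn x = 0 := by
    intro Ω hΩ hw
    have hloc : LocallyIntegrable (fun x => ψ.dfn x) :=
      (Lp.memLp ψ.dfn).locallyIntegrable (by norm_num)
    refine hΩ.ae_eq_zero_of_integral_contDiff_smul_eq_zero (hloc.locallyIntegrableOn _)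
      fun φ hφ hc hs => ?_
    have h1 := hw φ hφ hc hs
    have h2 : ∫ x, deriv φ x • ψ.fn x = 0 := by
      rw [hfn]
      refine integral_eq_zero_of_ae ?_
      filter_upwards [Lp.coeFn_zero ℂ 2 (volume : Measure ℝ)] with x hx
      rw [hx]
      simp
    rw [h2] at h1
    exact neg_eq_zero.1 h1.symm
  refine Q.ext' hfn ?_
  apply Lp.ext
  have h0 : ∀ᵐ x : ℝ, x ≠ 0 := by simp [ae_iff]
  filter_upwards [key _ isOpen_Ioi ψ.weakDeriv_right, key _ isOpen_Iio ψ.weakDeriv_left, h0,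
    Lp.coeFn_zero ℂ 2 (volume : Measure ℝ)] with x h1 h2 h3 h4
  change ψ.dfn x = (0 : L2) x
  rw [h4]
  rcases lt_or_gt_of_ne h3 with h | h
  · exact h2 h
  · exact h1 h

lemma powerNorm_pos_of_ne_zero {μ : ℝ} (hμ : 0 < μ) {ψ : Q} (h : ψ ≠ 0) : 0 < powerNorm μ ψ :=
  lt_of_le_of_ne (powerNorm_nonneg μ ψ) fun h0 => h (eq_zero_of_powerNorm_eq_zero hμ h0.symm)

/-! ### Scaling to the Nehari manifold -/

lemma rpow_inv_rpow {θ μ : ℝ} (hθ : 0 ≤ θ) (hμ : 0 < μ) :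
    (θ ^ (1 / (2 * μ))) ^ (2 * μ) = θ := by
  rw [← Real.rpow_mul hθ, one_div_mul_cancel (by positivity), Real.rpow_one]

lemma powerNorm_ofReal_smul {μ α : ℝ} (hμ : 0 < μ) (hα : 0 ≤ α) (ψ : Q) :
    powerNorm μ ((α : ℂ) • ψ) = α ^ (2 * μ) * α ^ 2 * powerNorm μ ψ := by
  rw [powerNorm_smul, Complex.norm_real, Real.norm_of_nonneg hα, rpow_two_mul_add_two hα hμ]

lemma nehari_ofReal_smul {γ lam μ ω α : ℝ} (hμ : 0 < μ) (hα : 0 ≤ α) (ψ : Q) :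
    nehari γ lam μ ω ((α : ℂ) • ψ)
      = α ^ 2 * (nehariQuad γ ω ψ - lam * (α ^ (2 * μ) * powerNorm μ ψ)) := by
  rw [nehari_eq, powerNorm_ofReal_smul hμ hα, nehariQuad_smul, Complex.norm_real,
    Real.norm_of_nonneg hα]
  ring

lemma ofReal_smul_ne_zero {α : ℝ} (hα : 0 < α) {ψ : Q} (h : ψ ≠ 0) : (α : ℂ) • ψ ≠ 0 :=
  smul_ne_zero (Complex.ofReal_ne_zero.2 hα.ne') h

lemma nehariManifold_subset (γ lam μ ω : ℝ) :
    nehariManifold γ lam μ ω ⊆ nehariRegion γ lam μ ω := fun _ h => ⟨h.1, h.2.le⟩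

lemma exists_smul_mem_nehariManifold {γ lam μ ω c : ℝ} (hlam : 0 < lam) (hμ : 0 < μ) (hc : 0 < c)
    (hcoer : ∀ ψ : Q, c * ‖ψ‖ ^ 2 ≤ nehariQuad γ ω ψ) {ψ : Q}
    (h : ψ ∈ nehariRegion γ lam μ ω) :
    ∃ α : ℝ, 0 < α ∧ α ≤ 1 ∧ (α : ℂ) • ψ ∈ nehariManifold γ lam μ ω ∧
      (nehari γ lam μ ω ψ < 0 → α < 1) := by
  have hP := powerNorm_pos_of_ne_zero hμ h.1
  have hN : 0 < nehariQuad γ ω ψ :=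
    lt_of_lt_of_le (by have := norm_pos_iff.2 h.1; positivity) (hcoer ψ)
  have hle := h.2
  rw [nehari_eq] at hle ⊢
  -- Scaling by α gives I(αψ) = α²(N - λ α^{2μ} P), so α^{2μ} = θ reaches the manifold, and I ≤ 0
  -- means θ ≤ 1.
  set θ := nehariQuad γ ω ψ / (lam * powerNorm μ ψ) with hθ
  have hθ0 : 0 < θ := by positivity
  have hθ1 : θ ≤ 1 := (div_le_one (by positivity)).2 (by linarith)
  have hα : 0 < θ ^ (1 / (2 * μ)) := Real.rpow_pos_of_pos hθ0 _
  refine ⟨θ ^ (1 / (2 * μ)), hα, Real.rpow_le_one hθ0.le hθ1 (by positivity),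
    ⟨ofReal_smul_ne_zero hα h.1, ?_⟩, fun hlt => ?_⟩
  · rw [nehari_ofReal_smul hμ hα.le, rpow_inv_rpow hθ0.le hμ, hθ]
    have : lam * (nehariQuad γ ω ψ / (lam * powerNorm μ ψ) * powerNorm μ ψ) = nehariQuad γ ω ψ := by
      field_simp
    rw [this, sub_self, mul_zero]
  · exact Real.rpow_lt_one hθ0.le ((div_lt_one (by positivity)).2 (by linarith)) (by positivity)

lemma nehariRegion_nonempty {γ lam μ ω : ℝ} (hlam : 0 < lam) (hμ : 0 < μ) :
    (nehariRegion γ lam μ ω).Nonempty := by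
  have h0 : rightUnit ≠ 0 := by
    intro h
    have h1 := rightValue_rightUnit
    rw [h, ← rightValueL_apply, map_zero] at h1
    exact zero_ne_one h1
  have hP := powerNorm_pos_of_ne_zero hμ h0
  -- The maximum with 1 keeps the scale positive, since coercivity is not assumed here.
  set θ := max 1 (nehariQuad γ ω rightUnit / (lam * powerNorm μ rightUnit)) with hθ
  have hθ0 : 0 < θ := lt_of_lt_of_le one_pos (le_max_left _ _)
  have hα : 0 < θ ^ (1 / (2 * μ)) := Real.rpow_pos_of_pos hθ0 _
  refine ⟨((θ ^ (1 / (2 * μ)) : ℝ) : ℂ) • rightUnit, ofReal_smul_ne_zero hα h0, ?_⟩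
  rw [nehari_ofReal_smul hμ hα.le, rpow_inv_rpow hθ0.le hμ]
  refine mul_nonpos_of_nonneg_of_nonpos (sq_nonneg _) ?_
  have h1 : nehariQuad γ ω rightUnit / (lam * powerNorm μ rightUnit) ≤ θ := le_max_right _ _
  rw [div_le_iff₀ (by positivity)] at h1
  linarith

/-- The infimum of the power functional over `I_ω ≤ 0`. -/
def level (γ lam μ ω : ℝ) : ℝ := sInf (powerNorm μ '' nehariRegion γ lam μ ω)

lemma bddBelow_powerNorm (γ lam μ ω : ℝ) : BddBelow (powerNorm μ '' nehariRegion γ lam μ ω) :=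
  ⟨0, by rintro _ ⟨ψ, -, rfl⟩; exact powerNorm_nonneg μ ψ⟩

lemma level_le {γ lam μ ω : ℝ} {ψ : Q} (h : ψ ∈ nehariRegion γ lam μ ω) :
    level γ lam μ ω ≤ powerNorm μ ψ :=
  csInf_le (bddBelow_powerNorm γ lam μ ω) (mem_image_of_mem _ h)

/-- On I ≤ 0 one has c‖ψ‖² ≤ N ≤ λP ≤ λ‖ψ‖^{2μ+2}. This bounds ‖ψ‖ from below, and then P ≥ c‖ψ‖²/λ.
-/
lemma level_pos {γ lam μ ω c : ℝ} (hlam : 0 < lam) (hμ : 0 < μ) (hc : 0 < c)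
    (hcoer : ∀ ψ : Q, c * ‖ψ‖ ^ 2 ≤ nehariQuad γ ω ψ) : 0 < level γ lam μ ω := by
  have hr : 0 < (c / lam) ^ (1 / (2 * μ)) := Real.rpow_pos_of_pos (by positivity) _
  have hm : 0 < c / lam * ((c / lam) ^ (1 / (2 * μ))) ^ 2 := by positivity
  refine lt_of_lt_of_le hm (le_csInf ((nehariRegion_nonempty hlam hμ).image _) ?_)
  rintro _ ⟨ψ, hψ, rfl⟩
  have h1 := hψ.2
  rw [nehari_eq] at h1
  have h2 := hcoer ψ
  have hn : 0 < ‖ψ‖ := norm_pos_iff.2 hψ.1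
  have h3 : c * ‖ψ‖ ^ 2 ≤ lam * powerNorm μ ψ := by linarith
  have h4 : c / lam ≤ ‖ψ‖ ^ (2 * μ) := by
    have h5 := mul_le_mul_of_nonneg_left (powerNorm_le hμ ψ) hlam.le
    have h6 : c * ‖ψ‖ ^ 2 ≤ (lam * ‖ψ‖ ^ (2 * μ)) * ‖ψ‖ ^ 2 := by linarith
    have h7 := le_of_mul_le_mul_right h6 (by positivity)
    rw [div_le_iff₀ hlam]
    linarith
  have h8 : (c / lam) ^ (1 / (2 * μ)) ≤ ‖ψ‖ := by
    have := Real.rpow_le_rpow (by positivity) h4 (z := 1 / (2 * μ)) (by positivity)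
    rwa [← Real.rpow_mul hn.le, mul_one_div_cancel (by positivity), Real.rpow_one] at this
  have h9 : ((c / lam) ^ (1 / (2 * μ))) ^ 2 ≤ ‖ψ‖ ^ 2 := pow_le_pow_left₀ hr.le h8 2
  calc c / lam * ((c / lam) ^ (1 / (2 * μ))) ^ 2 ≤ c / lam * ‖ψ‖ ^ 2 :=
        mul_le_mul_of_nonneg_left h9 (by positivity)
    _ = c * ‖ψ‖ ^ 2 / lam := by ring
    _ ≤ powerNorm μ ψ := by rw [div_le_iff₀ hlam]; linarith

lemma exists_norm_bound {γ lam μ ω c L : ℝ} (hlam : 0 < lam) (hc : 0 < c)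
    (hcoer : ∀ ψ : Q, c * ‖ψ‖ ^ 2 ≤ nehariQuad γ ω ψ) {u : ℕ → Q}
    (hu : ∀ n, u n ∈ nehariRegion γ lam μ ω)
    (hL : Tendsto (fun n => powerNorm μ (u n)) atTop (𝓝 L)) : ∃ M, ∀ n, ‖u n‖ ≤ M := by
  obtain ⟨B, hB⟩ := hL.bddAbove_range
  refine ⟨Real.sqrt (lam * B / c), fun n => Real.le_sqrt_of_sq_le ?_⟩
  have h1 := (hu n).2
  rw [nehari_eq] at h1
  have h2 := hcoer (u n)
  have h3 : lam * powerNorm μ (u n) ≤ lam * B :=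
    mul_le_mul_of_nonneg_left (hB ⟨n, rfl⟩) hlam.le
  rw [le_div_iff₀ hc]
  linarith

/-! ### Exclusion of vanishing -/

lemma powerNorm_parts {μ : ℝ} (hμ : 0 < μ) (ψ : Q) :
    powerNorm μ ψ.leftPart + powerNorm μ ψ.rightPart = powerNorm μ ψ := by
  have key : ∀ {s : Set ℝ} (hs : MeasurableSet s), ∫ x, ‖restrL2 hs ψ.fn x‖ ^ (2 * μ + 2)
      = ∫ x in s, ‖ψ.fn x‖ ^ (2 * μ + 2) := by
    intro s hs
    rw [← integral_indicator hs]
    refine integral_congr_ae ?_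
    filter_upwards [restrL2_coe hs ψ.fn] with x hx
    rw [hx]
    by_cases h : x ∈ s
    · rw [indicator_of_mem h, indicator_of_mem h]
    · rw [indicator_of_notMem h, indicator_of_notMem h, norm_zero, Real.zero_rpow (by linarith)]
  rw [powerNorm, powerNorm, powerNorm, Q.leftPart_fn, Q.rightPart_fn, key, key]
  exact integral_Iio_add_Ioi_real (integrable_rpow_fn hμ ψ)

lemma powerNorm_transl (μ : ℝ) (ψ : Q) (hr : ψ.rightValue = 0) (hl : ψ.leftValue = 0) (t : ℝ) :
    powerNorm μ (ψ.transl hr hl t) = powerNorm μ ψ := by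
  rw [powerNorm, powerNorm, ← integral_add_right_eq_self (fun x => ‖ψ.fn x‖ ^ (2 * μ + 2)) t]
  refine integral_congr_ae ?_
  filter_upwards [translL2_coe t ψ.fn] with x hx
  change ‖translL2 t ψ.fn x‖ ^ (2 * μ + 2) = _
  rw [hx]

/-- Cutting a function without jump at a point where it is large, and moving that point to the
origin, lowers the Nehari functional. -/
lemma exists_competitor {γ lam μ ω δ : ℝ} (hγ : 0 < γ) (hμ : 0 < μ) (hδ : 0 < δ) {w : Q}
    (hr : w.rightValue = 0) (hl : w.leftValue = 0) {t : ℝ} (ht : t ≠ 0)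
    (hwt : δ ≤ ‖evalL t w‖) :
    ∃ v : Q, v ≠ 0 ∧ powerNorm μ v ≤ powerNorm μ w ∧
      nehari γ lam μ ω v ≤ 1 / 2 * nehari γ lam μ ω w - γ⁻¹ * δ ^ 2 := by
  set z := w.transl hr hl t with hz
  have hzr : z.rightValue = evalL t w := Q.rightValue_transl w hr hl ht
  have hzl : z.leftValue = evalL t w := Q.leftValue_transl w hr hl ht
  have hd : ‖z.leftPart.dfn‖ ^ 2 + ‖z.rightPart.dfn‖ ^ 2 = ‖w.dfn‖ ^ 2 := by
    rw [← (translL2 t).norm_map w.dfn]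
    exact norm_restrL2_add z.dfn
  have hf : ‖z.leftPart.fn‖ ^ 2 + ‖z.rightPart.fn‖ ^ 2 = ‖w.fn‖ ^ 2 := by
    rw [← (translL2 t).norm_map w.fn]
    exact norm_restrL2_add z.fn
  have hP : powerNorm μ z.leftPart + powerNorm μ z.rightPart = powerNorm μ w := by
    rw [powerNorm_parts hμ, powerNorm_transl]
  have hj1 : ‖z.leftPart.rightValue - z.leftPart.leftValue‖ = ‖evalL t w‖ := by
    rw [Q.rightValue_leftPart, Q.leftValue_leftPart, hzl, zero_sub, norm_neg]
  have hj2 : ‖z.rightPart.rightValue - z.rightPart.leftValue‖ = ‖evalL t w‖ := by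
    rw [Q.rightValue_rightPart, Q.leftValue_rightPart, hzr, sub_zero]
  have hne : ∀ v : Q, ‖v.rightValue - v.leftValue‖ = ‖evalL t w‖ → v ≠ 0 := by
    intro v hv h0
    rw [← jumpL_apply, h0, map_zero, norm_zero] at hv
    linarith
  have hδ2 : γ⁻¹ * δ ^ 2 ≤ γ⁻¹ * ‖evalL t w‖ ^ 2 :=
    mul_le_mul_of_nonneg_left (pow_le_pow_left₀ hδ.le hwt 2) (inv_pos.2 hγ).le
  -- Derivative, mass and power terms are additive over the halves. The original has no jump,
  -- whereas each half jumps by |w(t)|; the half with the smaller I is the competitor.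
  have hsum : nehari γ lam μ ω z.leftPart + nehari γ lam μ ω z.rightPart
      = nehari γ lam μ ω w - 2 * (γ⁻¹ * ‖evalL t w‖ ^ 2) := by
    simp only [nehari, quadForm, mass]
    rw [hj1, hj2, ← hd, ← hf, ← hP, hr, hl, sub_zero, norm_zero]
    ring
  rcases le_total (nehari γ lam μ ω z.leftPart) (nehari γ lam μ ω z.rightPart) with h | h
  · exact ⟨z.leftPart, hne _ hj1, by linarith [powerNorm_nonneg μ z.rightPart], by linarith⟩
  · exact ⟨z.rightPart, hne _ hj2, by linarith [powerNorm_nonneg μ z.leftPart], by linarith⟩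

/-- If the Nehari functional is bounded away from zero, the level is not nearly attained. -/
lemma exists_level_le_mul {γ lam μ ω κ K : ℝ} (hlam : 0 < lam) (hμ : 0 < μ) (hκ : 0 < κ)
    (hK : 0 < K) :
    ∃ β < 1, ∀ v : Q, v ≠ 0 → powerNorm μ v ≤ K → nehari γ lam μ ω v ≤ -κ →
      level γ lam μ ω ≤ β * powerNorm μ v := by
  -- Scaling with α^{2μ} = θ raises N - λP by (1 - θ)λP ≤ κ, so the constraint I ≤ 0 survives. The
  -- value 1/2 only keeps θ positive.
  set θ := max (1 / 2) (1 - κ / (lam * K)) with hθ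
  have hθ0 : 0 < θ := lt_of_lt_of_le (by norm_num) (le_max_left _ _)
  have hθ1 : θ < 1 := max_lt (by norm_num) (by
    have : 0 < κ / (lam * K) := by positivity
    linarith)
  have hα : 0 < θ ^ (1 / (2 * μ)) := Real.rpow_pos_of_pos hθ0 _
  have hα1 : θ ^ (1 / (2 * μ)) ≤ 1 := Real.rpow_le_one hθ0.le hθ1.le (by positivity)
  refine ⟨θ, hθ1, fun v hv hPK hN => ?_⟩
  have hP0 := powerNorm_nonneg μ v
  have hmem : ((θ ^ (1 / (2 * μ)) : ℝ) : ℂ) • v ∈ nehariRegion γ lam μ ω := by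
    refine ⟨ofReal_smul_ne_zero hα hv, ?_⟩
    rw [nehari_ofReal_smul hμ hα.le, rpow_inv_rpow hθ0.le hμ]
    refine mul_nonpos_of_nonneg_of_nonpos (sq_nonneg _) ?_
    rw [nehari_eq] at hN
    have h1 : (1 - θ) * (lam * powerNorm μ v) ≤ κ / (lam * K) * (lam * K) := by
      refine mul_le_mul ?_ (mul_le_mul_of_nonneg_left hPK hlam.le) (by positivity) (by positivity)
      linarith [le_max_right (1 / 2) (1 - κ / (lam * K))]
    rw [div_mul_cancel₀ _ (by positivity)] at h1
    linarith
  refine (level_le hmem).trans ?_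
  rw [powerNorm_ofReal_smul hμ hα.le, rpow_inv_rpow hθ0.le hμ]
  refine mul_le_mul_of_nonneg_right ?_ hP0
  exact mul_le_of_le_one_right hθ0.le (pow_le_one₀ hα.le hα1)

lemma exists_evalL_ge {μ δ : ℝ} (hμ : 0 < μ) {w : Q}
    (h : δ ^ (2 * μ) * ‖w.fn‖ ^ 2 < powerNorm μ w) : ∃ t, t ≠ 0 ∧ δ ≤ ‖evalL t w‖ := by
  by_contra! hcon
  refine absurd (powerNorm_le_of_bound (δ := δ) hμ ?_) (not_le.2 h)
  have h0 : ∀ᵐ x : ℝ, x ≠ 0 := by simp [ae_iff]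
  filter_upwards [ae_eq_evalL w, h0] with x hx h1
  rw [hx]
  exact (hcon x h1).le

lemma not_weaklyTendsto_zero {γ lam μ ω c : ℝ} (hγ : 0 < γ) (hlam : 0 < lam) (hμ : 0 < μ)
    (hc : 0 < c) (hcoer : ∀ ψ : Q, c * ‖ψ‖ ^ 2 ≤ nehariQuad γ ω ψ) {u : ℕ → Q}
    (hu : ∀ n, u n ∈ nehariRegion γ lam μ ω)
    (hL : Tendsto (fun n => powerNorm μ (u n)) atTop (𝓝 (level γ lam μ ω))) :
    ¬ WeaklyTendsto u 0 := by
  intro hweak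
  have hLpos := level_pos hlam hμ hc hcoer
  set L := level γ lam μ ω with hLdef
  obtain ⟨M₀, hM₀⟩ := exists_norm_bound hlam hc hcoer hu hL
  have hra : Tendsto (fun n => rightValueL (u n)) atTop (𝓝 0) := by
    simpa using hweak rightValueL
  have hla : Tendsto (fun n => leftValueL (u n)) atTop (𝓝 0) := by
    simpa using hweak leftValueL
  -- Traces are weakly continuous, so they tend to zero; removing them is a perturbation vanishing
  -- in norm.
  let w : ℕ → Q := fun n => u n - (rightValueL (u n) • rightUnit + leftValueL (u n) • leftUnit)
  have hsub : ∀ n, w n - u n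
      = -(rightValueL (u n) • rightUnit + leftValueL (u n) • leftUnit) := fun n => by
    simp only [w]; abel
  have hdiff : Tendsto (fun n => ‖w n - u n‖) atTop (𝓝 0) := by
    have h1 := ((hra.smul_const rightUnit).add (hla.smul_const leftUnit)).neg
    simp only [zero_smul, add_zero, neg_zero] at h1
    simpa only [hsub, norm_zero] using h1.norm
  have hwr : ∀ n, (w n).rightValue = 0 := fun n => by
    rw [← rightValueL_apply]
    simp only [w, map_sub, map_add, map_smul]
    simp [rightValueL_apply, rightValue_rightUnit, rightValue_leftUnit]
  have hwl : ∀ n, (w n).leftValue = 0 := fun n => by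
    rw [← leftValueL_apply]
    simp only [w, map_sub, map_add, map_smul]
    simp [leftValueL_apply, leftValue_rightUnit, leftValue_leftUnit]
  obtain ⟨B, hB⟩ := hdiff.bddAbove_range
  have hB' : ∀ n, ‖w n - u n‖ ≤ B := fun n => hB ⟨n, rfl⟩
  have hB0 : 0 ≤ B := (norm_nonneg _).trans (hB' 0)
  set M := M₀ + B with hM
  have huM : ∀ n, ‖u n‖ ≤ M := fun n => by linarith [hM₀ n]
  have hwM : ∀ n, ‖w n‖ ≤ M := fun n => by
    have : ‖w n‖ ≤ ‖u n‖ + ‖w n - u n‖ := by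
      simpa using norm_add_le (u n) (w n - u n)
    linarith [hM₀ n, hB' n]
  obtain ⟨hPs, hNs⟩ := tendsto_nehari_sub (γ := γ) (lam := lam) (ω := ω) hμ huM hwM hdiff
  have hPw : Tendsto (fun n => powerNorm μ (w n)) atTop (𝓝 L) := by
    simpa using hPs.add hL
  -- If |w_n| stayed below δ, then P(w_n) would be at most δ^{2μ} M² ≤ L/4, contradicting P(w_n) →
  -- L.
  set δ := (L / (4 * (M ^ 2 + 1))) ^ (1 / (2 * μ)) with hδdef
  have hq : 0 < L / (4 * (M ^ 2 + 1)) := by positivity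
  have hδ : 0 < δ := Real.rpow_pos_of_pos hq _
  have hδμ : δ ^ (2 * μ) = L / (4 * (M ^ 2 + 1)) := rpow_inv_rpow hq.le hμ
  have hsmall : δ ^ (2 * μ) * M ^ 2 ≤ L / 4 := by
    rw [hδμ, div_mul_eq_mul_div, div_le_div_iff₀ (by positivity) (by positivity)]
    nlinarith
  -- Eventually I(w_n) < δ²/γ, so the competitor satisfies I ≤ ½ I(w_n) - δ²/γ ≤ -½ δ²/γ.
  have hκ : 0 < 1 / 2 * (γ⁻¹ * δ ^ 2) := by positivity
  obtain ⟨β, hβ, hlevel⟩ := exists_level_le_mul (γ := γ) (ω := ω) hlam hμ hκ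
    (show 0 < L + 1 by linarith)
  have ev1 : ∀ᶠ n in atTop, L / 2 < powerNorm μ (w n) :=
    hPw.eventually_const_lt (by linarith)
  have ev2 : ∀ᶠ n in atTop, powerNorm μ (w n) < L + 1 := hPw.eventually_lt_const (by linarith)
  have ev3 : ∀ᶠ n in atTop, nehari γ lam μ ω (w n) - nehari γ lam μ ω (u n) < γ⁻¹ * δ ^ 2 :=
    hNs.eventually_lt_const (by positivity)
  -- The factor β is only known to be below 1; a positive one is needed to multiply inequalities.
  have hβ0 : 0 < max β (1 / 2) := lt_of_lt_of_le (by norm_num) (le_max_right _ _)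
  have hβ1 : max β (1 / 2) < 1 := max_lt hβ (by norm_num)
  have ev : ∀ᶠ n in atTop, L ≤ max β (1 / 2) * powerNorm μ (w n) := by
    filter_upwards [ev1, ev2, ev3] with n h1 h2 h3
    have h4 : δ ^ (2 * μ) * ‖(w n).fn‖ ^ 2 < powerNorm μ (w n) := by
      have h5 : ‖(w n).fn‖ ^ 2 ≤ M ^ 2 :=
        pow_le_pow_left₀ (norm_nonneg _) ((w n).norm_fn_le.trans (hwM n)) 2
      have h6 := mul_le_mul_of_nonneg_left h5 (Real.rpow_nonneg hδ.le (2 * μ))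
      linarith
    obtain ⟨t, ht, hwt⟩ := exists_evalL_ge hμ h4
    obtain ⟨v, hv0, hvP, hvN⟩ := exists_competitor (γ := γ) (lam := lam) (ω := ω) hγ hμ hδ
      (hwr n) (hwl n) ht hwt
    have h7 := (hu n).2
    have h8 := hlevel v hv0 (by linarith) (by linarith)
    calc L ≤ β * powerNorm μ v := h8
      _ ≤ max β (1 / 2) * powerNorm μ v :=
        mul_le_mul_of_nonneg_right (le_max_left _ _) (powerNorm_nonneg μ v)
      _ ≤ max β (1 / 2) * powerNorm μ (w n) := mul_le_mul_of_nonneg_left hvP hβ0.le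
  have hfin : L ≤ max β (1 / 2) * L := ge_of_tendsto (hPw.const_mul _) ev
  nlinarith

/-! ### Strong convergence of minimizing sequences -/

lemma powerNorm_smul_lt {μ α : ℝ} (hμ : 0 < μ) (hα : 0 < α) (hα1 : α < 1) {ψ : Q}
    (hP : 0 < powerNorm μ ψ) : powerNorm μ ((α : ℂ) • ψ) < powerNorm μ ψ := by
  rw [powerNorm_ofReal_smul hμ hα.le]
  refine mul_lt_of_lt_one_left hP ?_
  exact mul_lt_one_of_nonneg_of_lt_one_left (Real.rpow_nonneg hα.le _)
    (Real.rpow_lt_one hα.le hα1 (by positivity)) (pow_le_one₀ hα.le hα1.le)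

theorem tendsto_of_minimizing {γ lam μ ω c : ℝ} (hγ : 0 < γ) (hlam : 0 < lam) (hμ : 0 < μ)
    (hc : 0 < c) (hcoer : ∀ ψ : Q, c * ‖ψ‖ ^ 2 ≤ nehariQuad γ ω ψ) {u : ℕ → Q} {ψ : Q}
    (hu : ∀ n, u n ∈ nehariRegion γ lam μ ω)
    (hL : Tendsto (fun n => powerNorm μ (u n)) atTop (𝓝 (level γ lam μ ω)))
    (hweak : WeaklyTendsto u ψ) :
    ψ ∈ nehariManifold γ lam μ ω ∧ powerNorm μ ψ = level γ lam μ ω ∧ Tendsto u atTop (𝓝 ψ) := by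
  have hψ : ψ ≠ 0 := by
    rintro rfl
    exact not_weaklyTendsto_zero hγ hlam hμ hc hcoer hu hL hweak
  have hPψ := powerNorm_pos_of_ne_zero hμ hψ
  set L := level γ lam μ ω with hLdef
  obtain ⟨M, hM⟩ := exists_norm_bound hlam hc hcoer hu hL
  have hPs := tendsto_powerNorm_split hμ hM hweak
  have hNs := tendsto_nehariQuad_split γ ω hweak
  have hPa : Tendsto (fun n => powerNorm μ (u n - ψ)) atTop (𝓝 (L - powerNorm μ ψ)) := by
    have := (hL.sub_const (powerNorm μ ψ)).sub hPs
    rw [sub_zero] at this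
    refine this.congr fun n => ?_
    ring
  have hPle : powerNorm μ ψ ≤ L := by
    have := ge_of_tendsto' hPa fun n => powerNorm_nonneg μ (u n - ψ)
    linarith
  have hIs : Tendsto (fun n => nehari γ lam μ ω (u n) - nehari γ lam μ ω (u n - ψ)
      - nehari γ lam μ ω ψ) atTop (𝓝 0) := by
    have := hNs.sub (hPs.const_mul lam)
    rw [mul_zero, sub_zero] at this
    refine this.congr fun n => ?_
    simp only [nehari_eq]
    ring
  have hmem : ψ ∈ nehariRegion γ lam μ ω := by
    refine ⟨hψ, ?_⟩
    -- If I(ψ) > 0, the splitting forces I(u_n - ψ) < 0 eventually. The remainder then competes for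
    -- the level, although its P tends to L - P(ψ) < L.
    by_contra! hpos
    have ev : ∀ᶠ n in atTop, L ≤ powerNorm μ (u n - ψ) := by
      filter_upwards [hIs.eventually_const_lt (show -nehari γ lam μ ω ψ < 0 by linarith)] with n hn
      have h1 := (hu n).2
      have h2 : nehari γ lam μ ω (u n - ψ) < 0 := by linarith
      refine level_le ⟨fun h0 => ?_, h2.le⟩
      -- Scaling by zero shows I(0) = 0, so I < 0 excludes a zero remainder.
      have h3 := nehari_ofReal_smul (γ := γ) (lam := lam) (ω := ω) hμ (le_refl 0) 0
      rw [smul_zero, zero_pow two_ne_zero, zero_mul] at h3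
      rw [h0, h3] at h2
      exact lt_irrefl _ h2
    have := ge_of_tendsto hPa ev
    linarith
  have hPeq : powerNorm μ ψ = L := le_antisymm hPle (level_le hmem)
  have hI0 : nehari γ lam μ ω ψ = 0 := by
    by_contra hne
    have hlt : nehari γ lam μ ω ψ < 0 := lt_of_le_of_ne hmem.2 hne
    obtain ⟨α, hα, -, hαm, hα1⟩ := exists_smul_mem_nehariManifold hlam hμ hc hcoer hmem
    have h1 := level_le (nehariManifold_subset _ _ _ _ hαm)
    have h2 := powerNorm_smul_lt hμ hα (hα1 hlt) hPψ
    rw [hPeq] at h2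
    exact absurd h1 (not_le.2 h2)
  refine ⟨⟨hψ, hI0⟩, hPeq, ?_⟩
  have hN0 : nehariQuad γ ω ψ = lam * L := by
    rw [nehari_eq, hPeq] at hI0
    linarith
  -- Coercivity on the remainder: up to the splitting error, N(u_n - ψ) is N(u_n) - N(ψ) ≤ λ(P(u_n)
  -- - L).
  have hbound : ∀ n, ‖u n - ψ‖ ^ 2 ≤ c⁻¹ * (lam * (powerNorm μ (u n) - L)
      - (nehariQuad γ ω (u n) - nehariQuad γ ω (u n - ψ) - nehariQuad γ ω ψ)) := by
    intro n
    have h1 := (hu n).2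
    rw [nehari_eq] at h1
    have h2 := hcoer (u n - ψ)
    rw [← div_eq_inv_mul, le_div_iff₀ hc, hN0]
    linarith
  have hlim : Tendsto (fun n => c⁻¹ * (lam * (powerNorm μ (u n) - L)
      - (nehariQuad γ ω (u n) - nehariQuad γ ω (u n - ψ) - nehariQuad γ ω ψ))) atTop (𝓝 0) := by
    simpa using (((hL.sub_const L).const_mul lam).sub hNs).const_mul c⁻¹
  have hsq : Tendsto (fun n => ‖u n - ψ‖ ^ 2) atTop (𝓝 0) :=
    squeeze_zero (fun n => sq_nonneg _) hbound hlim
  rw [tendsto_iff_norm_sub_tendsto_zero]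
  have := (Real.continuous_sqrt.tendsto 0).comp hsq
  rw [Real.sqrt_zero] at this
  refine this.congr fun n => ?_
  exact Real.sqrt_sq (norm_nonneg _)

lemma exists_minimizer {γ lam μ ω c : ℝ} (hγ : 0 < γ) (hlam : 0 < lam) (hμ : 0 < μ)
    (hc : 0 < c) (hcoer : ∀ ψ : Q, c * ‖ψ‖ ^ 2 ≤ nehariQuad γ ω ψ) :
    ∃ ψ ∈ nehariManifold γ lam μ ω, powerNorm μ ψ = level γ lam μ ω := by
  obtain ⟨s, -, hs, hmem⟩ := exists_seq_tendsto_sInf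
    ((nehariRegion_nonempty (γ := γ) (ω := ω) hlam hμ).image (powerNorm μ))
    (bddBelow_powerNorm γ lam μ ω)
  choose u hu hus using hmem
  have hL : Tendsto (fun n => powerNorm μ (u n)) atTop (𝓝 (level γ lam μ ω)) := by
    simp_rw [hus]
    exact hs
  obtain ⟨M, hM⟩ := exists_norm_bound hlam hc hcoer hu hL
  obtain ⟨ψ, k, hk, hw⟩ := exists_weaklyTendsto_subseq hM
  obtain ⟨h1, h2, -⟩ := tendsto_of_minimizing hγ hlam hμ hc hcoer (u := u ∘ k)
    (fun n => hu (k n)) (hL.comp hk.tendsto_atTop) hw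
  exact ⟨ψ, h1, h2⟩

end DeltaPrime

end

/-! ### Minimizers and minimizing sequences for the two problems -/

theorem theorem4p1 (γ lam μ ω : ℝ) (hγ : 0 < γ) (hlam : 0 < lam) (hμ : 0 < μ)
    (hω : 4 / γ ^ 2 < ω) :
    (∃ ψ : DeltaPrime.Q, ψ ≠ 0 ∧ DeltaPrime.nehari γ lam μ ω ψ = 0 ∧
      DeltaPrime.action γ lam μ ω ψ = DeltaPrime.d γ lam μ ω ∧
      IsLeast (DeltaPrime.action γ lam μ ω '' DeltaPrime.nehariManifold γ lam μ ω)
        (DeltaPrime.action γ lam μ ω ψ) ∧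
      IsLeast (DeltaPrime.reducedAction lam μ '' DeltaPrime.nehariRegion γ lam μ ω)
        (DeltaPrime.reducedAction lam μ ψ)) ∧
    (∀ (u : ℕ → DeltaPrime.Q) (ψ : DeltaPrime.Q),
      DeltaPrime.IsMinimizingSeq (DeltaPrime.action γ lam μ ω)
        (DeltaPrime.nehariManifold γ lam μ ω) u →
      DeltaPrime.WeaklyTendsto u ψ → Tendsto u atTop (𝓝 ψ)) ∧
    (∀ (u : ℕ → DeltaPrime.Q) (ψ : DeltaPrime.Q),
      DeltaPrime.IsMinimizingSeq (DeltaPrime.reducedAction lam μ)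
        (DeltaPrime.nehariRegion γ lam μ ω) u →
      DeltaPrime.WeaklyTendsto u ψ → Tendsto u atTop (𝓝 ψ)) := by
  open DeltaPrime in
  obtain ⟨c, hc, hcoer⟩ := exists_coercive hγ hω
  obtain ⟨ψ₀, hψ₀, hP₀⟩ := exists_minimizer hγ hlam hμ hc hcoer
  have hk : 0 < lam * μ / (2 * (μ + 1)) := by positivity
  have hact : ∀ φ ∈ nehariManifold γ lam μ ω, action γ lam μ ω φ = reducedAction lam μ φ := by
    intro φ hφ
    rw [action_eq hμ, hφ.2, mul_zero, zero_add]
  have hleast2 : IsLeast (reducedAction lam μ '' nehariRegion γ lam μ ω)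
      (reducedAction lam μ ψ₀) := by
    refine ⟨mem_image_of_mem _ (nehariManifold_subset _ _ _ _ hψ₀), ?_⟩
    rintro _ ⟨φ, hφ, rfl⟩
    refine mul_le_mul_of_nonneg_left ?_ hk.le
    rw [hP₀]
    exact level_le hφ
  have hleast1 : IsLeast (action γ lam μ ω '' nehariManifold γ lam μ ω)
      (action γ lam μ ω ψ₀) := by
    refine ⟨mem_image_of_mem _ hψ₀, ?_⟩
    rintro _ ⟨φ, hφ, rfl⟩
    rw [hact _ hψ₀, hact _ hφ]
    exact hleast2.2 (mem_image_of_mem _ (nehariManifold_subset _ _ _ _ hφ))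
  -- Either kind of minimizing sequence becomes a sequence in I ≤ 0 along which P tends to `level`,
  -- after division by the positive constant λμ/(2(μ+1)).
  have hlim : ∀ v : ℕ → Q, Tendsto (fun n => reducedAction lam μ (v n)) atTop
      (𝓝 (reducedAction lam μ ψ₀)) →
      Tendsto (fun n => powerNorm μ (v n)) atTop (𝓝 (level γ lam μ ω)) := by
    intro v hv
    have h1 := hv.const_mul (lam * μ / (2 * (μ + 1)))⁻¹
    rw [reducedAction, hP₀, inv_mul_cancel_left₀ hk.ne'] at h1
    refine h1.congr fun n => ?_
    rw [reducedAction, inv_mul_cancel_left₀ hk.ne']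
  refine ⟨⟨ψ₀, hψ₀.1, hψ₀.2, hleast1.csInf_eq.symm, hleast1, hleast2⟩, ?_, ?_⟩
  · rintro u ψ ⟨hu, m, hm, hum⟩ hw
    rw [hm.unique hleast1.isGLB, hact _ hψ₀] at hum
    refine (tendsto_of_minimizing hγ hlam hμ hc hcoer
      (fun n => nehariManifold_subset _ _ _ _ (hu n)) (hlim u ?_) hw).2.2
    exact hum.congr fun n => hact _ (hu n)
  · rintro u ψ ⟨hu, m, hm, hum⟩ hw
    rw [hm.unique hleast2.isGLB] at hum
    exact (tendsto_of_minimizing hγ hlam hμ hc hcoer hu (hlim u hum) hw).2.2
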